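/- Write $[z]_+=\max(z,0)$. A finite one-hidden-layer ReLU network $\theta=(k,w^{(1)},b^{(1)},w^{(2)},b^{(2)})$, with $k\in\mathbb N$, $w^{(1)},b^{(1)},w^{(2)}\in\mathbb R^k$ and $b^{(2)}\in\mathbb R$, computes $h_\theta(x)=\sum_{i=1}^k w^{(2)}_i[w^{(1)}_ix+b^{(1)}_i]_++b^{(2)}$ and has cost $C(\theta)=\frac12\sum_{i=1}^k\big((w^{(2)}_i)^2+(w^{(1)}_i)^2\big)$. For $f:\mathbb R\to\mathbb R$ let $$\overline R_{\mathrm{unif}}(f)=\lim_{\epsilon\to0^+}\ \inf\{C(\theta) : \sup_{x\in\mathbb R}|h_\theta(x)-f(x)|\le\epsilon\},$$ $$\overline R(f)=\inf\Big\{\|\alpha\|_1 : f(x)=\int_{\{\pm1\}\times\mathbb R}[wx+b]_+\,d\alpha(w,b)+c\ \text{ for all }x\in\mathbb R\Big\},$$ where in the second line $\alpha$ ranges over the finite signed measures on $\{\pm1\}\times\mathbb R$ for which the integral converges absolutely for every $x$, $c$ ranges over $\mathbb R$, $\|\alpha\|_1=|\alpha|(\{\pm1\}\times\mathbb R)$ is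 the total variation norm, and $\inf\emptyset=\infty$ throughout. Let $f:\mathbb R\to\mathbb R$ be continuous, and let $$\int_{-\infty}^{\infty}|f''|=\sup\Big\{\int_{\mathbb R} f\varphi'' : \varphi\in C_c^\infty(\mathbb R),\ |\varphi|\le1\Big\}\in[0,\infty]$$ be the total variation of its distributional second derivative. If $\int|f''|<\infty$, then $f$ is differentiable off a countable set and the limits $f'(\pm\infty)=\lim_{x\to\pm\infty}f'(x)$, taken along the points where $f$ is differentiable, exist. Let $$N(f)=\max\Big(\int_{-\infty}^\infty|f''|,\ |f'(-\infty)+f'(+\infty)|\Big),$$ read as $\infty$ if $\int|f''|=\infty$. Then $\overline R(f)=N(f)$. If moreover $f$ is a uniform limit on $\mathbb R$ of finite one-hidden-layer ReLU networks (of unrestricted cost), then $\overline R_{\mathrm{unif}}(f)=N(f)$ as well. Finally, $$N(f)\ \le\ \int_{-\infty}^\infty|f''|+2\inf_x|f'(x)|,$$ where the infimum is over the points $x$ at which $f$ is differentiable. -/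

import Mathlib

open MeasureTheory Filter Set
open scoped Topology ENNReal

noncomputable section

namespace ReLUNet

/-- The rectifier `[z]_+`. -/
def relu (z : ℝ) : ℝ := max z 0

/-- Parameters of a one-hidden-layer ReLU network with scalar input and output:
the width `k`, the hidden weights and biases, the output weights, the output bias. -/
structure Params where
  k : ℕ
  w₁ : Fin k → ℝ
  b₁ : Fin k → ℝ
  w₂ : Fin k → ℝ
  b₂ : ℝ

/-- The function computed by the network. -/
def Params.net (θ : Params) (x : ℝ) : ℝ :=
  ∑ i, θ.w₂ i * relu (θ.w₁ i * x + θ.b₁ i) + θ.b₂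

/-- Half the squared Euclidean norm of the non-bias weights. -/
def Params.cost (θ : Params) : ℝ :=
  (1 / 2) * ∑ i, ((θ.w₂ i) ^ 2 + (θ.w₁ i) ^ 2)

/-- `θ` computes a function within `ε` of `f` in the supremum norm on all of `ℝ`. -/
def Params.Within (θ : Params) (f : ℝ → ℝ) (ε : ℝ) : Prop :=
  ∀ x, |θ.net x - f x| ≤ ε

/-- The least cost of a finite network within `ε` of `f` (`∞` if there is none). -/
def costWithin (f : ℝ → ℝ) (ε : ℝ) : ℝ≥0∞ :=
  ⨅ (θ : Params) (_ : θ.Within f ε), ENNReal.ofReal θ.cost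

/-- `f` is a uniform limit on `ℝ` of finite networks, with no restriction on their cost. -/
def UniformlyApproximable (f : ℝ → ℝ) : Prop :=
  ∀ ε > 0, ∃ θ : Params, θ.Within f ε

/-- `f` is the infinite-width network `x ↦ ∫ [w x + b]_+ dα(w, b) + c`, where `α` is a finite signed
measure on `S⁰ × ℝ` and the integral is absolutely convergent for every `x`. -/
def Represents (α : SignedMeasure (Metric.sphere (0 : ℝ) 1 × ℝ)) (c : ℝ) (f : ℝ → ℝ) : Prop :=
  ∀ x : ℝ, VectorMeasure.Integrable α
      (fun p : Metric.sphere (0 : ℝ) 1 × ℝ => relu ((p.1 : ℝ) * x + p.2)) ∧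
    f x = VectorMeasure.integral α
      (fun p : Metric.sphere (0 : ℝ) 1 × ℝ => relu ((p.1 : ℝ) * x + p.2))
      (ContinuousLinearMap.lsmul ℝ ℝ) + c

/-- The least total variation norm `‖α‖₁` of an infinite-width network equal to `f`
(`∞` if there is none). -/
def infiniteWidthNorm (f : ℝ → ℝ) : ℝ≥0∞ :=
  ⨅ (α : SignedMeasure (Metric.sphere (0 : ℝ) 1 × ℝ)) (c : ℝ) (_ : Represents α c f),
    α.variation univ

/-- `∫ |f''|`: the total variation of the distributional second derivative of `f`, that is, the
supremum of `⟨f'', φ⟩ = ∫ f φ''` over the test functions `φ` with `|φ| ≤ 1`. -/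
def secondDerivTV (f : ℝ → ℝ) : ℝ≥0∞ :=
  ⨆ (φ : ℝ → ℝ) (_ : ContDiff ℝ ((⊤ : ℕ∞) : WithTop ℕ∞) φ ∧ HasCompactSupport φ ∧ ∀ x, |φ x| ≤ 1),
    ENNReal.ofReal (∫ x, f x * iteratedDeriv 2 φ x)

/-- The points where `f` has a derivative. -/
def diffSet (f : ℝ → ℝ) : Set ℝ := {x | DifferentiableAt ℝ f x}

/-- `f'(+∞)`: the limit at `+∞` of `f'` along the points where `f` is differentiable. -/
def slopeAtTop (f : ℝ → ℝ) : ℝ := limUnder (atTop ⊓ 𝓟 (diffSet f)) (deriv f)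

/-- `f'(-∞)`: the limit at `-∞` of `f'` along the points where `f` is differentiable. -/
def slopeAtBot (f : ℝ → ℝ) : ℝ := limUnder (atBot ⊓ 𝓟 (diffSet f)) (deriv f)

/-- `max (∫ |f''|) |f'(-∞) + f'(+∞)|`; it is `∞` whenever `∫ |f''|` is, whether or not the limits
exist. -/
def functionNorm (f : ℝ → ℝ) : ℝ≥0∞ :=
  max (secondDerivTV f) (ENNReal.ofReal |slopeAtBot f + slopeAtTop f|)

end ReLUNet

end

open scoped NNReal

/-! Lower bound. A unit `[w x + b]_+` with `|w| = 1` has as second derivative a unit point mass at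
its kink, and its slopes at `-∞` and `+∞` add up to `w = ±1`. Superposing units with coefficients of
total mass `m` therefore gives both `∫ |f''| ≤ m` and `|f'(-∞) + f'(+∞)| ≤ m`. For a finite network
`m = ∑ |w₂ w₁|`, which is at most the cost by the arithmetic-geometric mean inequality. Testing
against `φ''` makes the first bound stable under uniform approximation; the second holds at every
accuracy, because functions at bounded distance have the same slopes at infinity.

Upper bound. Let `v = ∫ |f''|` and `S = f'(-∞) + f'(+∞)`. A kink at `t` may be carried by `[x -
t]_+` or by `[t - x]_+`, which differ by an affine function. Dividing the kinks between the two
directions leaves their cost `v` unchanged and lets them contribute any slope sum `ρ v` with `|ρ| ≤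
1`. What is missing is a linear term `a x = a [x]_+ - a [-x]_+` with `2 a = S - ρ v`, of cost `2
|a|`. The total `v + |S - ρ v|` is `max v |S|` for the best `ρ` (`exists_balance`).

Two obstacles remain. With infinite width, a fixed division of all kinks may have divergent
integrals, since `f''` need not have a first moment; far kinks are therefore given to the
outward-facing unit, and the cutoff tends to infinity (`share`, `split`). With finite width, uniform
approximability makes `f` asymptotic to lines, so that interpolation on a bounded fine grid suffices
(`exists_within_cost_le`).

All this rests on writing `f' = P - Q` with `P`, `Q` bounded and monotone and of total increase at
most `v` (`exists_isSlopeDecomposition`), obtained from the distributional definition by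
mollification and lower semicontinuity of the variation. -/

namespace ReLUNet


/-! ### Mollification: from test functions to the variation of smooth derivatives -/

section Mollification

variable {f k : ℝ → ℝ}

lemma hasDerivAt_primitive (hk : Continuous k) (z : ℝ) :
    HasDerivAt (fun z => ∫ t in (0 : ℝ)..z, k t) (k z) z :=
  (hk.integral_hasStrictDerivAt 0 z).hasDerivAt

lemma contDiff_primitive (hk : ContDiff ℝ ((⊤ : ℕ∞) : WithTop ℕ∞) k) :
    ContDiff ℝ ((⊤ : ℕ∞) : WithTop ℕ∞) (fun z => ∫ t in (0 : ℝ)..z, k t) := by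
  rw [contDiff_infty_iff_deriv]
  refine ⟨fun z => (hasDerivAt_primitive hk.continuous z).differentiableAt, ?_⟩
  rwa [funext fun z => (hasDerivAt_primitive hk.continuous z).deriv]

/-- The test function `y ↦ ∑ σᵢ ∫ (uᵢ - y)..(uᵢ₊₁ - y), k`, a mollified step function. -/
noncomputable def smoothStep (k : ℝ → ℝ) (σ u : ℕ → ℝ) (n : ℕ) (y : ℝ) : ℝ :=
  ∑ i ∈ Finset.range n,
    σ i * ((∫ t in (0 : ℝ)..(u (i + 1) - y), k t) - ∫ t in (0 : ℝ)..(u i - y), k t)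

lemma contDiff_smoothStep (hk : ContDiff ℝ ((⊤ : ℕ∞) : WithTop ℕ∞) k) (σ u : ℕ → ℝ) (n : ℕ) :
    ContDiff ℝ ((⊤ : ℕ∞) : WithTop ℕ∞) (smoothStep k σ u n) := by
  have h (c : ℝ) : ContDiff ℝ ((⊤ : ℕ∞) : WithTop ℕ∞) (fun y => ∫ t in (0 : ℝ)..(c - y), k t) :=
    (contDiff_primitive hk).comp (contDiff_const.sub contDiff_id)
  exact ContDiff.sum fun i _ => contDiff_const.mul ((h _).sub (h _))

lemma smoothStep_eq_zero {R : ℝ} (hR : ∀ z, z ∉ Icc (-R) R → k z = 0) (hk : Continuous k)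
    (σ u : ℕ → ℝ) (hu : Monotone u) (n : ℕ) {y : ℝ} (hy : y ∉ Icc (u 0 - R) (u n + R)) :
    smoothStep k σ u n y = 0 := by
  refine Finset.sum_eq_zero fun i hi => ?_
  have h0 : u 0 ≤ u i := hu (Nat.zero_le _)
  have h1 : u i ≤ u (i + 1) := hu (Nat.le_succ _)
  have h2 : u (i + 1) ≤ u n := hu (Finset.mem_range.1 hi)
  rw [intervalIntegral.integral_interval_sub_left (hk.intervalIntegrable _ _)
    (hk.intervalIntegrable _ _)]
  rw [intervalIntegral.integral_congr (g := fun _ => 0), intervalIntegral.integral_zero, mul_zero]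
  intro t ht
  rw [uIcc_of_le (by linarith)] at ht
  apply hR
  rintro ⟨h3, h4⟩
  apply hy
  exact ⟨by linarith [ht.1, ht.2], by linarith [ht.1, ht.2]⟩

/-- Without the signs `σ` the sum telescopes to the mass of `k` on one interval. -/
lemma abs_smoothStep_le (hk : Continuous k) (hki : Integrable k) (h0 : ∀ x, 0 ≤ k x)
    (h1 : ∫ x, k x = 1)
    {σ u : ℕ → ℝ} (hσ : ∀ i, |σ i| ≤ 1) (hu : Monotone u) (n : ℕ) (y : ℝ) :
    |smoothStep k σ u n y| ≤ 1 := by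
  have hle (i : ℕ) :
      0 ≤ (∫ t in (0 : ℝ)..(u (i + 1) - y), k t) - ∫ t in (0 : ℝ)..(u i - y), k t := by
    rw [intervalIntegral.integral_interval_sub_left (hk.intervalIntegrable _ _)
      (hk.intervalIntegrable _ _)]
    exact intervalIntegral.integral_nonneg (by linarith [hu (Nat.le_succ i)]) fun _ _ => h0 _
  calc |smoothStep k σ u n y| ≤ ∑ i ∈ Finset.range n,
        ((∫ t in (0 : ℝ)..(u (i + 1) - y), k t) - ∫ t in (0 : ℝ)..(u i - y), k t) := by
        refine (Finset.abs_sum_le_sum_abs _ _).trans (Finset.sum_le_sum fun i _ => ?_)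
        rw [abs_mul, abs_of_nonneg (hle i)]
        exact mul_le_of_le_one_left (hle i) (hσ i)
    _ = ∫ t in (u 0 - y)..(u n - y), k t := by
        rw [Finset.sum_range_sub (fun i => ∫ t in (0 : ℝ)..(u i - y), k t),
          intervalIntegral.integral_interval_sub_left (hk.intervalIntegrable _ _)
          (hk.intervalIntegrable _ _)]
    _ ≤ 1 := by
        rw [intervalIntegral.integral_of_le (by linarith [hu (Nat.zero_le n)]), ← h1]
        exact setIntegral_le_integral hki (Eventually.of_forall h0)

/-- Integrated against `f`, this gives the signed increments of the mollified derivative along the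
points `u i`. -/
lemma iteratedDeriv_two_smoothStep (hk : ContDiff ℝ ((⊤ : ℕ∞) : WithTop ℕ∞) k) (σ u : ℕ → ℝ) (n : ℕ)
    (y : ℝ) :
    iteratedDeriv 2 (smoothStep k σ u n) y =
      ∑ i ∈ Finset.range n, σ i * (deriv k (u (i + 1) - y) - deriv k (u i - y)) := by
  have hsub (c y : ℝ) : HasDerivAt (fun y => c - y) (-1) y := by
    simpa using (hasDerivAt_id y).const_sub c
  have h1 : deriv (smoothStep k σ u n) =
      fun y => ∑ i ∈ Finset.range n, σ i * (k (u i - y) - k (u (i + 1) - y)) := by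
    ext y
    refine HasDerivAt.deriv ?_
    refine HasDerivAt.fun_sum fun i _ => HasDerivAt.const_mul _ ?_
    have h (c : ℝ) := (hasDerivAt_primitive hk.continuous (c - y)).comp y (hsub c y)
    convert! (h (u (i + 1))).sub (h (u i)) using 1
    ring
  rw [iteratedDeriv_succ, iteratedDeriv_one, h1]
  refine HasDerivAt.deriv ?_
  refine HasDerivAt.fun_sum fun i _ => HasDerivAt.const_mul _ ?_
  have h (c : ℝ) := ((hk.differentiable (by simp)) (c - y)).hasDerivAt.comp y (hsub c y)
  convert! (h (u i)).sub (h (u (i + 1))) using 1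
  ring

lemma integrable_mul_comp_sub (hf : Continuous f) (hk : Continuous k) (hc : HasCompactSupport k)
    (x : ℝ) : Integrable (fun y => f y * k (x - y)) :=
  (hf.mul (hk.comp (continuous_const.sub continuous_id))).integrable_of_hasCompactSupport
    ((hc.comp_homeomorph (Homeomorph.subLeft x)).mul_left)

/-- The derivative of a mollification of `f` varies by at most the total variation of the
distributional second derivative of `f`. -/
lemma eVariationOn_integral_mul_deriv_le (hf : Continuous f)
    (hk : ContDiff ℝ ((⊤ : ℕ∞) : WithTop ℕ∞) k) (hc : HasCompactSupport k) (h0 : ∀ x, 0 ≤ k x)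
    (h1 : ∫ x, k x = 1) :
    eVariationOn (fun x => ∫ y, f y * deriv k (x - y)) univ ≤ secondDerivTV f := by
  set G : ℝ → ℝ := fun x => ∫ y, f y * deriv k (x - y) with hG
  refine iSup_le fun ⟨n, u, hu, _⟩ => ?_
  -- With these signs the pairing becomes the sum of the absolute increments of `G`.
  set σ : ℕ → ℝ := fun i => if G (u i) ≤ G (u (i + 1)) then 1 else -1 with hσ
  have hσ1 (i : ℕ) : |σ i| ≤ 1 := by
    simp only [hσ]; split_ifs <;> simp
  obtain ⟨R, hR⟩ : ∃ R, ∀ z, z ∉ Icc (-R) R → k z = 0 := by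
    obtain ⟨R, hR⟩ := hc.isCompact.isBounded.subset_closedBall 0
    refine ⟨R, fun z hz => ?_⟩
    by_contra h
    apply hz
    have := hR (subset_tsupport _ (Function.mem_support.2 h))
    rwa [Metric.mem_closedBall, dist_zero_right, Real.norm_eq_abs, abs_le] at this
  have hdc : HasCompactSupport (deriv k) := hc.deriv
  have hdk : Continuous (deriv k) := hk.continuous_deriv (by simp)
  have hInt (i : ℕ) := integrable_mul_comp_sub hf hdk hdc (u i)
  have key : ∫ y, f y * iteratedDeriv 2 (smoothStep k σ u n) y =
      ∑ i ∈ Finset.range n, |G (u (i + 1)) - G (u i)| := by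
    simp_rw [iteratedDeriv_two_smoothStep hk, Finset.mul_sum]
    rw [integral_finsetSum]
    · refine Finset.sum_congr rfl fun i _ => ?_
      have : ∀ y, f y * (σ i * (deriv k (u (i + 1) - y) - deriv k (u i - y))) =
        σ i * (f y * deriv k (u (i + 1) - y) - f y * deriv k (u i - y)) := fun y => by ring
      simp_rw [this]
      rw [integral_const_mul, integral_sub (hInt _) (hInt _)]
      change σ i * (G _ - G _) = _
      simp only [hσ]
      split_ifs with h
      · rw [abs_of_nonneg (by linarith)]; ring
      · rw [abs_of_neg (by linarith)]; ring
    · intro i _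
      have : ∀ y, f y * (σ i * (deriv k (u (i + 1) - y) - deriv k (u i - y))) =
        σ i * (f y * deriv k (u (i + 1) - y) - f y * deriv k (u i - y)) := fun y => by ring
      simp_rw [this]
      exact ((hInt _).sub (hInt _)).const_mul _
  have hsum : ∑ i ∈ Finset.range n, edist (G (u (i + 1))) (G (u i)) =
      ENNReal.ofReal (∑ i ∈ Finset.range n, |G (u (i + 1)) - G (u i)|) := by
    rw [ENNReal.ofReal_sum_of_nonneg fun _ _ => abs_nonneg _]
    exact Finset.sum_congr rfl fun i _ => by rw [edist_dist, Real.dist_eq]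
  simp only [hsum, ← key]
  exact le_iSup₂ (f := fun (φ : ℝ → ℝ)
    (_ : ContDiff ℝ ((⊤ : ℕ∞) : WithTop ℕ∞) φ ∧ HasCompactSupport φ ∧ ∀ x, |φ x| ≤ 1) =>
    ENNReal.ofReal (∫ x, f x * iteratedDeriv 2 φ x)) (smoothStep k σ u n)
    ⟨contDiff_smoothStep hk σ u n, HasCompactSupport.intro isCompact_Icc fun y hy =>
      smoothStep_eq_zero hR hk.continuous σ u hu n hy,
      abs_smoothStep_le hk.continuous (hk.continuous.integrable_of_hasCompactSupport hc)
        h0 h1 hσ1 hu n⟩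

/-- A continuous function is the pointwise limit of differentiable functions whose derivatives are
continuous and vary by at most the total variation of its distributional second derivative. -/
lemma exists_tendsto_of_eVariationOn_deriv_le (hf : Continuous f) :
    ∃ F G : ℕ → ℝ → ℝ, (∀ n x, HasDerivAt (F n) (G n x) x) ∧ (∀ n, Continuous (G n)) ∧
      (∀ n, eVariationOn (G n) univ ≤ secondDerivTV f) ∧
      ∀ x, Tendsto (fun n => F n x) atTop (𝓝 (f x)) := by
  let ψ (n : ℕ) : ContDiffBump (0 : ℝ) :=
    { rIn := 1 / (2 * (n + 1)), rOut := 1 / (n + 1), rIn_pos := by positivity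
      rIn_lt_rOut := by gcongr; linarith }
  let k (n : ℕ) : ℝ → ℝ := (ψ n).normed volume
  have hk (n : ℕ) : ContDiff ℝ ((⊤ : ℕ∞) : WithTop ℕ∞) (k n) := (ψ n).contDiff_normed
  have hc (n : ℕ) : HasCompactSupport (k n) := (ψ n).hasCompactSupport_normed
  have hdk (n : ℕ) : Continuous (deriv (k n)) := (hk n).continuous_deriv (by simp)
  refine ⟨fun n => convolution f (k n) (ContinuousLinearMap.mul ℝ ℝ) volume,
    fun n => convolution f (deriv (k n)) (ContinuousLinearMap.mul ℝ ℝ) volume, ?_, ?_, ?_, ?_⟩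
  · intro n x
    exact (hc n).hasDerivAt_convolution_right _ hf.locallyIntegrable ((hk n).of_le (by simp)) x
  · intro n
    exact (hc n).deriv.continuous_convolution_right _ hf.locallyIntegrable (hdk n)
  · intro n
    exact eVariationOn_integral_mul_deriv_le hf (hk n) (hc n) ((ψ n).nonneg_normed)
      (ψ n).integral_normed
  · intro x
    have := ContDiffBump.convolution_tendsto_right_of_continuous (φ := ψ) (l := atTop)
      (μ := (volume : Measure ℝ)) tendsto_one_div_add_atTop_nhds_zero_nat hf x
    refine this.congr fun n => ?_
    rw [← convolution_flip]
    simp [convolution, k, mul_comm]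

end Mollification


/-! ### Jordan decomposition of the slope and its limits at infinity -/

section Structure

variable {f : ℝ → ℝ}

lemma eVariationOn_le_of_tendsto {ι : Type*} {l : Filter ι} [l.NeBot] {F : ι → ℝ → ℝ} {g : ℝ → ℝ}
    {s : Set ℝ} {v : ℝ≥0∞} (hF : ∀ᶠ i in l, eVariationOn (F i) s ≤ v)
    (h : ∀ x ∈ s, Tendsto (fun i => F i x) l (𝓝 (g x))) : eVariationOn g s ≤ v := by
  by_contra! hv
  obtain ⟨i, h1, h2⟩ := ((eVariationOn.lowerSemicontinuous_aux h hv).and hF).exists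
  exact absurd h1 (not_lt.2 h2)

/-- Translates have the same variation, and the variation is convex. A difference quotient with step
`c` is such an average of the derivative. -/
lemma eVariationOn_average_le {G : ℝ → ℝ} (hG : Continuous G) {v : ℝ≥0∞} (hv : v ≠ ⊤)
    (h : eVariationOn G univ ≤ v) (c : ℝ) :
    eVariationOn (fun x => ∫ s in (0 : ℝ)..1, G (x + c * s)) univ ≤ v := by
  refine iSup_le fun ⟨n, u, hu, _⟩ => ?_
  have hI (x : ℝ) : IntervalIntegrable (fun s => G (x + c * s)) volume 0 1 :=
    (by fun_prop : Continuous fun s => G (x + c * s)).intervalIntegrable _ _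
  have hsum : ∑ i ∈ Finset.range n, edist (∫ s in (0 : ℝ)..1, G (u (i + 1) + c * s))
      (∫ s in (0 : ℝ)..1, G (u i + c * s)) =
      ENNReal.ofReal (∑ i ∈ Finset.range n, |(∫ s in (0 : ℝ)..1, G (u (i + 1) + c * s)) -
        ∫ s in (0 : ℝ)..1, G (u i + c * s)|) := by
    rw [ENNReal.ofReal_sum_of_nonneg fun _ _ => abs_nonneg _]
    exact Finset.sum_congr rfl fun i _ => by rw [edist_dist, Real.dist_eq]
  simp only [hsum]
  refine ENNReal.ofReal_le_of_le_toReal ?_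
  calc _ ≤ ∑ i ∈ Finset.range n, ∫ s in (0 : ℝ)..1, |G (u (i + 1) + c * s) - G (u i + c * s)| := by
        refine Finset.sum_le_sum fun i _ => ?_
        rw [← intervalIntegral.integral_sub (hI _) (hI _)]
        exact intervalIntegral.abs_integral_le_integral_abs zero_le_one
    _ = ∫ s in (0 : ℝ)..1, ∑ i ∈ Finset.range n, |G (u (i + 1) + c * s) - G (u i + c * s)| := by
        rw [intervalIntegral.integral_finsetSum]
        exact fun i _ => ((hI _).sub (hI _)).abs
    _ ≤ ∫ s in (0 : ℝ)..1, v.toReal := by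
        refine intervalIntegral.integral_mono_on zero_le_one ?_ (by simp) fun s _ => ?_
        · exact (by fun_prop : Continuous fun s =>
            ∑ i ∈ Finset.range n, |G (u (i + 1) + c * s) - G (u i + c * s)|).intervalIntegrable _ _
        · refine (ENNReal.ofReal_le_iff_le_toReal hv).1 ?_
          rw [ENNReal.ofReal_sum_of_nonneg fun _ _ => abs_nonneg _]
          refine le_trans (le_of_eq ?_) ((eVariationOn.sum_le (f := G) (s := univ) (n := n)
            (u := fun i => u i + c * s) (fun i j hij => by simpa using hu hij)
            (fun _ => mem_univ _)).trans h)
          exact Finset.sum_congr rfl fun i _ => by rw [edist_dist, Real.dist_eq]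
    _ = v.toReal := by simp

lemma eVariationOn_difference_quotient_le (hf : Continuous f) (hV : secondDerivTV f ≠ ⊤) {h : ℝ}
    (hh : h ≠ 0) :
    eVariationOn (fun x => h⁻¹ • (f (x + h) - f x)) univ ≤ secondDerivTV f := by
  obtain ⟨F, G, hFG, hG, hvar, hlim⟩ := exists_tendsto_of_eVariationOn_deriv_le hf
  refine eVariationOn_le_of_tendsto (l := atTop) (F := fun n x => h⁻¹ • (F n (x + h) - F n x))
    (Eventually.of_forall fun n => ?_) fun x _ => ((hlim _).sub (hlim _)).const_smul _
  refine le_trans (le_of_eq ?_) (eVariationOn_average_le (hG n) hV (hvar n) h)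
  congr 1
  ext x
  rw [intervalIntegral.integral_comp_add_mul _ hh,
    intervalIntegral.integral_eq_sub_of_hasDerivAt (f := F n) (fun y _ => hFG n y)
      ((hG n).intervalIntegrable _ _)]
  simp

/-- The variation controls only differences of slopes, so every chord is compared with the chord
over `[0, 1]`. -/
lemma exists_lipschitzWith (hf : Continuous f) (hV : secondDerivTV f ≠ ⊤) :
    ∃ K, LipschitzWith K f := by
  obtain ⟨F, G, hFG, hG, hvar, hlim⟩ := exists_tendsto_of_eVariationOn_deriv_le hf
  set V := (secondDerivTV f).toReal
  have hGV (n : ℕ) (x y : ℝ) : |G n x - G n y| ≤ V := by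
    have := (eVariationOn.edist_le (G n) (mem_univ x) (mem_univ y)).trans (hvar n)
    rw [edist_dist, Real.dist_eq] at this
    exact (ENNReal.ofReal_le_iff_le_toReal hV).1 this
  have hmv (n : ℕ) {a b : ℝ} (hab : a < b) : ∃ c, F n b - F n a = G n c * (b - a) := by
    obtain ⟨c, -, hc⟩ := exists_hasDerivAt_eq_slope (F n) (G n) hab
      (fun x _ => (hFG n x).continuousAt.continuousWithinAt) fun x _ => hFG n x
    exact ⟨c, by rw [hc, div_mul_cancel₀ _ (sub_ne_zero.2 hab.ne')]⟩
  have key {a b : ℝ} (hab : a < b) : |(f b - f a) - (f 1 - f 0) * (b - a)| ≤ V * (b - a) := by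
    refine le_of_tendsto (((((hlim b).sub (hlim a)).sub
      (((hlim 1).sub (hlim 0)).mul_const (b - a)))).abs) (Eventually.of_forall fun n => ?_)
    obtain ⟨c, hc⟩ := hmv n hab
    obtain ⟨d, hd⟩ := hmv n (zero_lt_one' ℝ)
    rw [hc, hd, sub_zero, mul_one, ← sub_mul, abs_mul, abs_of_pos (sub_pos.2 hab)]
    exact mul_le_mul_of_nonneg_right (hGV n c d) (sub_pos.2 hab).le
  have key' {a b : ℝ} (hab : a < b) : |f b - f a| ≤ (V + |f 1 - f 0|) * (b - a) := by
    have h1 := key hab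
    have h2 : |(f 1 - f 0) * (b - a)| = |f 1 - f 0| * (b - a) := by
      rw [abs_mul, abs_of_pos (sub_pos.2 hab)]
    have h3 := abs_add_le ((f b - f a) - (f 1 - f 0) * (b - a)) ((f 1 - f 0) * (b - a))
    rw [sub_add_cancel] at h3
    linarith
  refine ⟨Real.toNNReal (V + |f 1 - f 0|), LipschitzWith.of_dist_le_mul fun x y => ?_⟩
  rw [Real.coe_toNNReal _ (by positivity), Real.dist_eq, Real.dist_eq]
  rcases lt_trichotomy x y with h | rfl | h
  · rw [abs_sub_comm, abs_sub_comm x y, abs_of_pos (sub_pos.2 h)]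
    exact key' h
  · simp
  · rw [abs_of_pos (sub_pos.2 h)]
    exact key' h

/-- The variation is lower semicontinuous, and `deriv f` is on `diffSet f` the pointwise limit of
the difference quotients. -/
lemma eVariationOn_deriv_diffSet_le (hf : Continuous f) (hV : secondDerivTV f ≠ ⊤) :
    eVariationOn (deriv f) (diffSet f) ≤ secondDerivTV f := by
  refine eVariationOn_le_of_tendsto (l := 𝓝[≠] (0 : ℝ))
    (F := fun h x => h⁻¹ • (f (x + h) - f x)) ?_ fun x hx => ?_
  · filter_upwards [self_mem_nhdsWithin] with h hh
    exact (eVariationOn.mono _ (subset_univ _)).trans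
      (eVariationOn_difference_quotient_le hf hV hh)
  · exact hasDerivAt_iff_tendsto_slope_zero.1 (DifferentiableAt.hasDerivAt hx)

/-- `f'` is the difference of the bounded monotone functions `P` and `Q`, whose limits at `-∞` and
`+∞` are `p₀`, `p₁` and `q₀`, `q₁`. -/
structure IsSlopeDecomposition (f P Q : ℝ → ℝ) (p₀ p₁ q₀ q₁ : ℝ) : Prop where
  monotone_left : Monotone P
  monotone_right : Monotone Q
  left_atBot : Tendsto P atBot (𝓝 p₀)
  left_atTop : Tendsto P atTop (𝓝 p₁)
  right_atBot : Tendsto Q atBot (𝓝 q₀)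
  right_atTop : Tendsto Q atTop (𝓝 q₁)
  integral_eq : ∀ x y, ∫ t in x..y, (P t - Q t) = f y - f x
  deriv_eq : ∀ x ∈ diffSet f, deriv f x = P x - Q x

lemma neBot_inf_principal_of_ae {s : Set ℝ} (hs : ∀ᵐ x, x ∈ s) :
    (atTop ⊓ 𝓟 s).NeBot ∧ (atBot ⊓ 𝓟 s).NeBot := by
  have hd : Dense s := Measure.dense_of_ae hs
  constructor
  · rw [inf_principal_neBot_iff]
    intro U hU
    obtain ⟨a, ha⟩ := mem_atTop_sets.1 hU
    obtain ⟨x, hx, hxs⟩ := hd.exists_between (lt_add_one a)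
    exact ⟨x, ha x hxs.1.le, hx⟩
  · rw [inf_principal_neBot_iff]
    intro U hU
    obtain ⟨a, ha⟩ := mem_atBot_sets.1 hU
    obtain ⟨x, hx, hxs⟩ := hd.exists_between (sub_one_lt a)
    exact ⟨x, ha x hxs.2.le, hx⟩

lemma exists_monotone_extension_tendsto {p : ℝ → ℝ} {s : Set ℝ} (hs : s.Nonempty)
    (hp : MonotoneOn p s) {C : ℝ} (hC : ∀ x ∈ s, |p x| ≤ C) :
    ∃ (P : ℝ → ℝ) (p₀ p₁ : ℝ), Monotone P ∧ EqOn p P s ∧ Tendsto P atBot (𝓝 p₀) ∧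
      Tendsto P atTop (𝓝 p₁) := by
  obtain ⟨P, hP, hPe⟩ := hp.exists_monotone_extension
    ⟨-C, by rintro _ ⟨x, hx, rfl⟩; exact (abs_le.1 (hC x hx)).1⟩
    ⟨C, by rintro _ ⟨x, hx, rfl⟩; exact (abs_le.1 (hC x hx)).2⟩
  have hC0 : -C ≤ C := by
    obtain ⟨x, hx⟩ := hs
    have := (abs_nonneg _).trans (hC x hx)
    linarith
  -- Clamping keeps the extension monotone, does not change it on `s`, and makes its limits exist.
  let P' : ℝ → ℝ := fun x => max (-C) (min C (P x))
  have hP' : Monotone P' := fun x y h => max_le_max le_rfl (min_le_min le_rfl (hP h))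
  refine ⟨P', ⨅ x, P' x, ⨆ x, P' x, hP', fun x hx => ?_, tendsto_atBot_ciInf hP' ?_,
    tendsto_atTop_ciSup hP' ?_⟩
  · have := abs_le.1 (hC x hx)
    simp only [P', ← hPe hx]
    rw [min_eq_right this.2, max_eq_right this.1]
  · exact ⟨-C, by rintro _ ⟨x, rfl⟩; exact le_max_left _ _⟩
  · exact ⟨C, by rintro _ ⟨x, rfl⟩; exact max_le hC0 (min_le_left _ _)⟩

/-- If the distributional second derivative has finite total variation, `f'` is the difference of
two bounded monotone functions whose total increase is at most this total variation. -/
theorem exists_isSlopeDecomposition (hf : Continuous f) (hV : secondDerivTV f ≠ ⊤) :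
    ∃ (P Q : ℝ → ℝ) (p₀ p₁ q₀ q₁ : ℝ), IsSlopeDecomposition f P Q p₀ p₁ q₀ q₁ ∧
      ENNReal.ofReal ((p₁ - p₀) + (q₁ - q₀)) ≤ secondDerivTV f := by
  obtain ⟨K, hK⟩ := exists_lipschitzWith hf hV
  set D := diffSet f with hD
  have hae : ∀ᵐ x, x ∈ D := hK.ae_differentiableAt_real
  have hvar := eVariationOn_deriv_diffSet_le hf hV
  have hbv : BoundedVariationOn (deriv f) D := ne_top_of_le_ne_top hV hvar
  have hloc := hbv.locallyBoundedVariationOn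
  have hne : D.Nonempty := (Measure.dense_of_ae hae).nonempty
  obtain ⟨a, ha⟩ := hne
  set v := variationOnFromTo (deriv f) D a with hv
  set V := (secondDerivTV f).toReal with hVdef
  have hvV (x y : ℝ) : |variationOnFromTo (deriv f) D x y| ≤ V :=
    (variationOnFromTo.abs_le_eVariationOn hbv).trans (ENNReal.toReal_mono hV hvar)
  have hdK (x : ℝ) : |deriv f x| ≤ K := by
    simpa using norm_deriv_le_of_lipschitz (x₀ := x) hK
  -- Increments of the variation function `v` dominate those of `f'`, so `(v + f') / 2` and `(v -
  -- f') / 2` are monotone on `D`; their sum is `v`, whose total increase is at most `V`.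
  obtain ⟨P, p₀, p₁, hP, hPe, hP0, hP1⟩ := exists_monotone_extension_tendsto
    (p := fun x => (v x + deriv f x) / 2) (s := D) ⟨a, ha⟩
    (fun x hx y hy hxy => by
      have := abs_le.1 (variationOnFromTo.abs_sub_le_sub_of_le hloc ha hx hy hxy)
      simp only [hv]; linarith) (C := V + K)
    (fun x hx => by
      have h1 := abs_le.1 (hvV a x)
      have h2 := abs_le.1 (hdK x)
      rw [abs_le]; simp only [hv]; constructor <;> linarith)
  obtain ⟨Q, q₀, q₁, hQ, hQe, hQ0, hQ1⟩ := exists_monotone_extension_tendsto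
    (p := fun x => (v x - deriv f x) / 2) (s := D) ⟨a, ha⟩
    (fun x hx y hy hxy => by
      have := abs_le.1 (variationOnFromTo.abs_sub_le_sub_of_le hloc ha hx hy hxy)
      simp only [hv]; linarith) (C := V + K)
    (fun x hx => by
      have h1 := abs_le.1 (hvV a x)
      have h2 := abs_le.1 (hdK x)
      rw [abs_le]; simp only [hv]; constructor <;> linarith)
  have hderiv (x : ℝ) (hx : x ∈ D) : deriv f x = P x - Q x := by
    rw [← hPe hx, ← hQe hx]; ring
  refine ⟨P, Q, p₀, p₁, q₀, q₁, ⟨hP, hQ, hP0, hP1, hQ0, hQ1, fun x y => ?_, hderiv⟩, ?_⟩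
  · rw [← (hK.lipschitzOnWith (s := uIcc x y)).absolutelyContinuousOnInterval.integral_deriv_eq_sub]
    refine intervalIntegral.integral_congr_ae ?_
    filter_upwards [hae] with t ht _
    exact (hderiv t ht).symm
  · refine ENNReal.ofReal_le_of_le_toReal ?_
    obtain ⟨hT, hB⟩ := neBot_inf_principal_of_ae hae
    have hsum (x y : ℝ) (hx : x ∈ D) (hy : y ∈ D) : (P x - P y) + (Q x - Q y) ≤ V := by
      rw [← hPe hx, ← hQe hx, ← hPe hy, ← hQe hy]
      have h1 := le_of_abs_le (hvV y x)
      have h2 := variationOnFromTo.sub_right hloc ha hx hy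
      linarith
    have h1 (y : ℝ) (hy : y ∈ D) : (p₁ - P y) + (q₁ - Q y) ≤ V := by
      refine le_of_tendsto (((hP1.sub_const _).add (hQ1.sub_const _)).mono_left
        (inf_le_left : atTop ⊓ 𝓟 D ≤ atTop)) ?_
      filter_upwards [mem_inf_of_right (mem_principal_self D)] with x hx
      exact hsum x y hx hy
    refine le_of_tendsto (((hP0.const_sub p₁).add (hQ0.const_sub q₁)).mono_left
        (inf_le_left : atBot ⊓ 𝓟 D ≤ atBot)) ?_
    filter_upwards [mem_inf_of_right (mem_principal_self D)] with y hy
    exact h1 y hy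

namespace IsSlopeDecomposition

variable {P Q : ℝ → ℝ} {p₀ p₁ q₀ q₁ : ℝ}

/-- As a primitive of `P - Q`, `f` is differentiable wherever both monotone functions are
continuous. -/
lemma countable_compl_diffSet (h : IsSlopeDecomposition f P Q p₀ p₁ q₀ q₁) :
    (diffSet f)ᶜ.Countable := by
  refine (h.monotone_left.countable_not_continuousAt.union
    h.monotone_right.countable_not_continuousAt).mono fun x hx => ?_
  by_contra hc
  simp only [mem_union, mem_ofPred_eq, not_or, not_not] at hc
  apply hx
  have hI (a b : ℝ) : IntervalIntegrable (fun t => P t - Q t) volume a b :=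
    h.monotone_left.intervalIntegrable.sub h.monotone_right.intervalIntegrable
  have h1 : HasDerivAt (fun u => ∫ t in (0 : ℝ)..u, (P t - Q t)) (P x - Q x) x :=
    intervalIntegral.integral_hasDerivAt_right (hI 0 x)
      (h.monotone_left.measurable.sub
        h.monotone_right.measurable).stronglyMeasurable.stronglyMeasurableAtFilter
      (hc.1.sub hc.2)
  have h2 : f = fun u => (∫ t in (0 : ℝ)..u, (P t - Q t)) + f 0 := by
    ext u; rw [h.integral_eq]; ring
  rw [diffSet, mem_ofPred_eq, h2]
  exact (h1.add_const _).differentiableAt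

lemma ae_mem_diffSet (h : IsSlopeDecomposition f P Q p₀ p₁ q₀ q₁) : ∀ᵐ x, x ∈ diffSet f :=
  h.countable_compl_diffSet.measure_zero _

lemma tendsto_deriv_atTop (h : IsSlopeDecomposition f P Q p₀ p₁ q₀ q₁) :
    Tendsto (deriv f) (atTop ⊓ 𝓟 (diffSet f)) (𝓝 (p₁ - q₁)) := by
  refine ((h.left_atTop.sub h.right_atTop).mono_left inf_le_left).congr' ?_
  filter_upwards [mem_inf_of_right (mem_principal_self _)] with x hx
  exact (h.deriv_eq x hx).symm

lemma tendsto_deriv_atBot (h : IsSlopeDecomposition f P Q p₀ p₁ q₀ q₁) :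
    Tendsto (deriv f) (atBot ⊓ 𝓟 (diffSet f)) (𝓝 (p₀ - q₀)) := by
  refine ((h.left_atBot.sub h.right_atBot).mono_left inf_le_left).congr' ?_
  filter_upwards [mem_inf_of_right (mem_principal_self _)] with x hx
  exact (h.deriv_eq x hx).symm

lemma slopeAtTop_eq (h : IsSlopeDecomposition f P Q p₀ p₁ q₀ q₁) : slopeAtTop f = p₁ - q₁ :=
  have := (neBot_inf_principal_of_ae h.ae_mem_diffSet).1
  h.tendsto_deriv_atTop.limUnder_eq

lemma slopeAtBot_eq (h : IsSlopeDecomposition f P Q p₀ p₁ q₀ q₁) : slopeAtBot f = p₀ - q₀ :=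
  have := (neBot_inf_principal_of_ae h.ae_mem_diffSet).2
  h.tendsto_deriv_atBot.limUnder_eq

lemma left_mem (h : IsSlopeDecomposition f P Q p₀ p₁ q₀ q₁) (x : ℝ) : P x ∈ Icc p₀ p₁ :=
  ⟨h.monotone_left.le_of_tendsto h.left_atBot x, h.monotone_left.ge_of_tendsto h.left_atTop x⟩

lemma right_mem (h : IsSlopeDecomposition f P Q p₀ p₁ q₀ q₁) (x : ℝ) : Q x ∈ Icc q₀ q₁ :=
  ⟨h.monotone_right.le_of_tendsto h.right_atBot x, h.monotone_right.ge_of_tendsto h.right_atTop x⟩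

/-- The slope of a chord of `f` lies between the extreme values of `P - Q` permitted by the
monotonicity of `P` and `Q`. -/
lemma chord_mem (h : IsSlopeDecomposition f P Q p₀ p₁ q₀ q₁) {x y : ℝ} (hxy : x ≤ y) :
    f y - f x ∈ Icc ((P x - Q y) * (y - x)) ((P y - Q x) * (y - x)) := by
  have hI : IntervalIntegrable (fun t => P t - Q t) volume x y :=
    h.monotone_left.intervalIntegrable.sub h.monotone_right.intervalIntegrable
  rw [← h.integral_eq]
  constructor
  · have := intervalIntegral.integral_mono_on hxy (by simp) hI fun t ht =>
      sub_le_sub (h.monotone_left ht.1) (h.monotone_right ht.2)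
    rwa [intervalIntegral.integral_const, smul_eq_mul, mul_comm] at this
  · have := intervalIntegral.integral_mono_on hxy hI (by simp) fun t ht =>
      sub_le_sub (h.monotone_left ht.2) (h.monotone_right ht.1)
    rwa [intervalIntegral.integral_const, smul_eq_mul, mul_comm] at this

/-- The chord over `[x, 2 x]` has slope `2 (f (2 x) / (2 x)) - f x / x`, which tends to `2 A - A`,
while monotonicity squeezes it to `p₁ - q₁`. -/
lemma eq_of_tendsto_div_atTop (h : IsSlopeDecomposition f P Q p₀ p₁ q₀ q₁) {A : ℝ}
    (hA : Tendsto (fun x => f x / x) atTop (𝓝 A)) : A = p₁ - q₁ := by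
  have h2 : Tendsto (fun x : ℝ => 2 * x) atTop atTop := tendsto_id.const_mul_atTop two_pos
  have h3 : Tendsto (fun x => 2 * (f (2 * x) / (2 * x)) - f x / x) atTop (𝓝 (2 * A - A)) :=
    ((hA.comp h2).const_mul 2).sub hA
  rw [show 2 * A - A = A by ring] at h3
  refine tendsto_nhds_unique h3 (tendsto_of_tendsto_of_tendsto_of_le_of_le'
    (h.left_atTop.sub (h.right_atTop.comp h2)) ((h.left_atTop.comp h2).sub h.right_atTop) ?_ ?_)
  all_goals
    filter_upwards [eventually_gt_atTop 0] with x hx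
    have := h.chord_mem (show x ≤ 2 * x by linarith)
    rw [show 2 * x - x = x by ring] at this
    have h4 : 2 * (f (2 * x) / (2 * x)) - f x / x = (f (2 * x) - f x) / x := by field_simp
    rw [h4]
  · exact (le_div_iff₀ hx).2 this.1
  · exact (div_le_iff₀ hx).2 this.2

lemma eq_of_tendsto_div_atBot (h : IsSlopeDecomposition f P Q p₀ p₁ q₀ q₁) {A : ℝ}
    (hA : Tendsto (fun x => f x / x) atBot (𝓝 A)) : A = p₀ - q₀ := by
  have h2 : Tendsto (fun x : ℝ => 2 * x) atBot atBot := tendsto_id.const_mul_atBot two_pos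
  have h3 : Tendsto (fun x => 2 * (f (2 * x) / (2 * x)) - f x / x) atBot (𝓝 (2 * A - A)) :=
    ((hA.comp h2).const_mul 2).sub hA
  rw [show 2 * A - A = A by ring] at h3
  refine tendsto_nhds_unique h3 (tendsto_of_tendsto_of_tendsto_of_le_of_le'
    ((h.left_atBot.comp h2).sub h.right_atBot) (h.left_atBot.sub (h.right_atBot.comp h2)) ?_ ?_)
  all_goals
    filter_upwards [eventually_lt_atBot 0] with x hx
    have := h.chord_mem (show 2 * x ≤ x by linarith)
    rw [show x - 2 * x = -x by ring] at this
    have h4 : 2 * (f (2 * x) / (2 * x)) - f x / x = (f x - f (2 * x)) / (-x) := by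
      have := hx.ne
      field_simp
      ring
    rw [h4]
  · exact (le_div_iff₀ (neg_pos.2 hx)).2 this.1
  · exact (div_le_iff₀ (neg_pos.2 hx)).2 this.2

end IsSlopeDecomposition

/-- The norm is at most the total variation of `f''` plus twice the least slope. -/
theorem functionNorm_le_add (hf : Continuous f) :
    functionNorm f ≤ secondDerivTV f + 2 * ⨅ x ∈ diffSet f, ENNReal.ofReal |deriv f x| := by
  by_cases hV : secondDerivTV f = ⊤
  · simp [hV]
  obtain ⟨P, Q, p₀, p₁, q₀, q₁, h, hle⟩ := exists_isSlopeDecomposition hf hV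
  refine max_le le_self_add ?_
  rw [ENNReal.mul_iInf_of_ne two_ne_zero ENNReal.ofNat_ne_top, ENNReal.add_iInf]
  refine le_iInf fun x => ?_
  rw [ENNReal.mul_iInf_of_ne two_ne_zero ENNReal.ofNat_ne_top, ENNReal.add_iInf]
  refine le_iInf fun hx => ?_
  rw [h.slopeAtTop_eq, h.slopeAtBot_eq]
  have hP := h.left_mem x
  have hQ := h.right_mem x
  have hd := h.deriv_eq x hx
  refine le_trans ?_ (add_le_add_left hle _)
  rw [show (2 : ℝ≥0∞) = ENNReal.ofReal 2 by simp, ← ENNReal.ofReal_mul zero_le_two,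
    ← ENNReal.ofReal_add (by linarith [hP.1, hP.2, hQ.1, hQ.2]) (by positivity)]
  refine ENNReal.ofReal_le_ofReal ?_
  -- The sum of the end slopes minus `2 f'(x)` is `(p₀ + p₁ - 2 P x) - (q₀ + q₁ - 2 Q x)`, whose
  -- terms are at most `p₁ - p₀` and `q₁ - q₀` in absolute value.
  rw [abs_le]
  have h1 := le_abs_self (deriv f x)
  have h2 := neg_abs_le (deriv f x)
  constructor <;> linarith [hP.1, hP.2, hQ.1, hQ.2]

end Structure


/-! ### Elementary properties of the rectifier -/

lemma continuous_relu : Continuous relu := continuous_id.max continuous_const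

lemma relu_nonneg (z : ℝ) : 0 ≤ relu z := le_max_right _ _

lemma relu_of_nonneg {z : ℝ} (h : 0 ≤ z) : relu z = z := max_eq_left h

lemma relu_of_nonpos {z : ℝ} (h : z ≤ 0) : relu z = 0 := max_eq_right h

lemma relu_sub_relu_neg (z : ℝ) : relu z - relu (-z) = z := by
  rcases le_total 0 z with h | h
  · rw [relu_of_nonneg h, relu_of_nonpos (by linarith), sub_zero]
  · rw [relu_of_nonpos h, relu_of_nonneg (by linarith)]; ring

lemma relu_add_relu_neg (z : ℝ) : relu z + relu (-z) = |z| := by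
  rcases le_total 0 z with h | h
  · rw [relu_of_nonneg h, relu_of_nonpos (by linarith), add_zero, abs_of_nonneg h]
  · rw [relu_of_nonpos h, relu_of_nonneg (by linarith), abs_of_nonpos h]; ring

/-! ### Pairing units with second derivatives of test functions -/

section TestFunction

/-- The test functions in the definition of `secondDerivTV`. -/
def IsTest (φ : ℝ → ℝ) : Prop :=
  ContDiff ℝ ((⊤ : ℕ∞) : WithTop ℕ∞) φ ∧ HasCompactSupport φ ∧ ∀ x, |φ x| ≤ 1

variable {φ : ℝ → ℝ}

lemma iteratedDeriv_two_eq (φ : ℝ → ℝ) : iteratedDeriv 2 φ = deriv (deriv φ) := by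
  rw [iteratedDeriv_succ, iteratedDeriv_one]

lemma IsTest.contDiff_deriv (hφ : IsTest φ) :
    ContDiff ℝ ((⊤ : ℕ∞) : WithTop ℕ∞) (deriv φ) :=
  (contDiff_infty_iff_deriv.1 hφ.1).2

lemma IsTest.continuous_iteratedDeriv (hφ : IsTest φ) : Continuous (iteratedDeriv 2 φ) := by
  rw [iteratedDeriv_two_eq]
  exact hφ.contDiff_deriv.continuous_deriv (by simp)

lemma IsTest.hasCompactSupport_iteratedDeriv (hφ : IsTest φ) :
    HasCompactSupport (iteratedDeriv 2 φ) := by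
  rw [iteratedDeriv_two_eq]
  exact hφ.2.1.deriv.deriv

lemma IsTest.integrable_mul (hφ : IsTest φ) {g : ℝ → ℝ} (hg : Continuous g) :
    Integrable fun x => g x * iteratedDeriv 2 φ x :=
  (hg.mul hφ.continuous_iteratedDeriv).integrable_of_hasCompactSupport
    hφ.hasCompactSupport_iteratedDeriv.mul_left

/-- The integrand is the derivative of `(x - t) φ' - φ`, which has compact support and the value `-φ
t` at `t`. -/
lemma IsTest.integral_linear_mul (hφ : IsTest φ) (t : ℝ) :
    ∫ x in Ioi t, (x - t) * iteratedDeriv 2 φ x = φ t ∧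
      ∫ x in Iic t, (x - t) * iteratedDeriv 2 φ x = -φ t := by
  set F : ℝ → ℝ := fun x => (x - t) * deriv φ x - φ x with hF
  have hd : deriv F = fun x => (x - t) * iteratedDeriv 2 φ x := by
    ext x
    refine HasDerivAt.deriv ?_
    have h1 := (hφ.contDiff_deriv.differentiable (by simp) x).hasDerivAt
    have h2 := (hφ.1.differentiable (by simp) x).hasDerivAt
    convert! (((hasDerivAt_id x).sub_const t).mul h1).sub h2 using 1
    rw [iteratedDeriv_two_eq]
    simp
  have hc : ContDiff ℝ 1 F := by
    refine ContDiff.of_le (n := ((⊤ : ℕ∞) : WithTop ℕ∞)) ?_ (by simp)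
    exact ((contDiff_id.sub contDiff_const).mul hφ.contDiff_deriv).sub hφ.1
  have hs : HasCompactSupport F := (hφ.2.1.deriv.mul_left).sub hφ.2.1
  rw [← hd, hs.integral_Ioi_deriv_eq hc, hs.integral_Iic_deriv_eq hc]
  simp [hF]

lemma IsTest.integral_iteratedDeriv (hφ : IsTest φ) : ∫ x, iteratedDeriv 2 φ x = 0 := by
  have hc : ContDiff ℝ 1 (deriv φ) := hφ.contDiff_deriv.of_le (by simp)
  have hi : Integrable (iteratedDeriv 2 φ) :=
    hφ.continuous_iteratedDeriv.integrable_of_hasCompactSupport hφ.hasCompactSupport_iteratedDeriv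
  rw [← intervalIntegral.integral_Iic_add_Ioi (b := 0) hi.integrableOn hi.integrableOn,
    iteratedDeriv_two_eq, hφ.2.1.deriv.integral_Ioi_deriv_eq hc,
    hφ.2.1.deriv.integral_Iic_deriv_eq hc]
  simp

/-- The distributional second derivative of `x ↦ [w x + b]_+` is a point mass `|w|` at its kink. -/
lemma IsTest.integral_relu_mul (hφ : IsTest φ) (w b : ℝ) :
    ∫ x, relu (w * x + b) * iteratedDeriv 2 φ x = |w| * φ (-b / w) := by
  rcases lt_trichotomy w 0 with h | rfl | h
  · have : (fun x => relu (w * x + b) * iteratedDeriv 2 φ x) =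
        (Iic (-b / w)).indicator fun x => w * ((x - -b / w) * iteratedDeriv 2 φ x) := by
      ext x
      have e : w * x + b = w * (x - -b / w) := by
        have := h.ne
        field_simp
        ring
      by_cases hx : x ≤ -b / w
      · rw [indicator_of_mem (mem_Iic.2 hx), e, relu_of_nonneg]
        · ring
        · exact mul_nonneg_of_nonpos_of_nonpos h.le (by linarith)
      · rw [indicator_of_notMem (by simpa using hx), e, relu_of_nonpos, zero_mul]
        exact mul_nonpos_of_nonpos_of_nonneg h.le (by linarith)
    rw [this, integral_indicator measurableSet_Iic, integral_const_mul,
      (hφ.integral_linear_mul _).2, abs_of_neg h]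
    ring
  -- For `w = 0` the unit is constant, and the default value `-b / 0 = 0` is harmless because its
  -- weight is `|0|`.
  · simp [integral_const_mul, hφ.integral_iteratedDeriv]
  · have : (fun x => relu (w * x + b) * iteratedDeriv 2 φ x) =
        (Ioi (-b / w)).indicator fun x => w * ((x - -b / w) * iteratedDeriv 2 φ x) := by
      ext x
      have e : w * x + b = w * (x - -b / w) := by
        have := h.ne'
        field_simp
        ring
      by_cases hx : -b / w < x
      · rw [indicator_of_mem (mem_Ioi.2 hx), e, relu_of_nonneg]
        · ring
        · exact mul_nonneg h.le (by linarith)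
      · rw [indicator_of_notMem (by simpa using hx), e, relu_of_nonpos, zero_mul]
        exact mul_nonpos_of_nonneg_of_nonpos h.le (by linarith)
    rw [this, integral_indicator measurableSet_Ioi, integral_const_mul,
      (hφ.integral_linear_mul _).1, abs_of_pos h]

end TestFunction

/-! ### Lower bounds for the cost of finite networks, and their asymptotes -/

section Networks

variable {f φ : ℝ → ℝ} (θ : Params)

lemma Params.continuous_net : Continuous θ.net := by
  unfold Params.net
  have := continuous_relu
  fun_prop

lemma Params.sum_abs_mul_le_cost : ∑ i, |θ.w₂ i| * |θ.w₁ i| ≤ θ.cost := by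
  rw [Params.cost, Finset.mul_sum]
  refine Finset.sum_le_sum fun i _ => ?_
  have h1 := sq_abs (θ.w₁ i)
  have h2 := sq_abs (θ.w₂ i)
  nlinarith [sq_nonneg (|θ.w₂ i| - |θ.w₁ i|)]

lemma Params.integral_net_mul_le (hφ : IsTest φ) :
    ∫ x, θ.net x * iteratedDeriv 2 φ x ≤ θ.cost := by
  have hi (i : Fin θ.k) : Integrable fun x =>
      θ.w₂ i * (relu (θ.w₁ i * x + θ.b₁ i) * iteratedDeriv 2 φ x) :=
    (hφ.integrable_mul (continuous_relu.comp (by fun_prop))).const_mul _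
  have hc : Integrable fun x => θ.b₂ * iteratedDeriv 2 φ x := hφ.integrable_mul continuous_const
  have : (fun x => θ.net x * iteratedDeriv 2 φ x) = fun x =>
      (∑ i, θ.w₂ i * (relu (θ.w₁ i * x + θ.b₁ i) * iteratedDeriv 2 φ x)) +
        θ.b₂ * iteratedDeriv 2 φ x := by
    ext x
    rw [Params.net, add_mul, Finset.sum_mul]
    simp only [mul_assoc]
  rw [this, integral_add (integrable_finsetSum _ fun i _ => hi i) hc,
    integral_finsetSum _ fun i _ => hi i, integral_const_mul, hφ.integral_iteratedDeriv, mul_zero,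
    add_zero]
  refine le_trans (Finset.sum_le_sum fun i _ => ?_) θ.sum_abs_mul_le_cost
  rw [integral_const_mul, hφ.integral_relu_mul]
  refine (le_abs_self _).trans ?_
  rw [abs_mul, abs_mul, abs_abs]
  exact mul_le_mul_of_nonneg_left (mul_le_of_le_one_right (abs_nonneg _) (hφ.2.2 _)) (abs_nonneg _)

/-- For a fixed test function the error term vanishes as `ε → 0`, which gives the lower bound by `∫
|f''|` in the limit. -/
lemma Params.Within.integral_mul_le {θ : Params} {ε : ℝ} (hf : Continuous f) (hθ : θ.Within f ε)
    (hφ : IsTest φ) :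
    ∫ x, f x * iteratedDeriv 2 φ x ≤ θ.cost + ε * ∫ x, |iteratedDeriv 2 φ x| := by
  have h1 := hφ.integrable_mul hf
  have h2 := hφ.integrable_mul θ.continuous_net
  have h3 : Integrable fun x => ε * |iteratedDeriv 2 φ x| :=
    ((hφ.continuous_iteratedDeriv.integrable_of_hasCompactSupport
      hφ.hasCompactSupport_iteratedDeriv).abs).const_mul ε
  refine le_trans ?_ (add_le_add_left (θ.integral_net_mul_le hφ) _)
  rw [← integral_const_mul, ← integral_add h2 h3]
  refine integral_mono h1 (h2.add h3) fun x => ?_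
  have h4 : (f x - θ.net x) * iteratedDeriv 2 φ x ≤ ε * |iteratedDeriv 2 φ x| := by
    refine (le_abs_self _).trans ?_
    rw [abs_mul, abs_sub_comm]
    exact mul_le_mul_of_nonneg_right (hθ x) (abs_nonneg _)
  simp only
  linarith

lemma eventually_relu_affine_atTop (w b : ℝ) :
    ∃ c, ∀ᶠ x in atTop, relu (w * x + b) = relu w * x + c := by
  rcases lt_trichotomy w 0 with h | rfl | h
  · refine ⟨0, ?_⟩
    filter_upwards [eventually_ge_atTop (-b / w)] with x hx
    rw [div_le_iff_of_neg h] at hx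
    rw [relu_of_nonpos (by linarith), relu_of_nonpos h.le]; simp
  · exact ⟨relu b, by simp [relu]⟩
  · refine ⟨b, ?_⟩
    filter_upwards [eventually_ge_atTop (-b / w)] with x hx
    rw [div_le_iff₀ h] at hx
    rw [relu_of_nonneg (by linarith), relu_of_nonneg h.le]

lemma eventually_relu_affine_atBot (w b : ℝ) :
    ∃ c, ∀ᶠ x in atBot, relu (w * x + b) = -relu (-w) * x + c := by
  obtain ⟨c, hc⟩ := eventually_relu_affine_atTop (-w) b
  refine ⟨c, ?_⟩
  filter_upwards [tendsto_neg_atBot_atTop.eventually hc] with x hx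
  rw [neg_mul_neg] at hx
  rw [hx]; ring

lemma Params.eventually_affine_atTop :
    ∃ c, ∀ᶠ x in atTop, θ.net x = (∑ i, θ.w₂ i * relu (θ.w₁ i)) * x + c := by
  choose c hc using fun i => eventually_relu_affine_atTop (θ.w₁ i) (θ.b₁ i)
  refine ⟨∑ i, θ.w₂ i * c i + θ.b₂, ?_⟩
  filter_upwards [eventually_all.2 hc] with x hx
  simp only [Params.net, hx, mul_add, Finset.sum_add_distrib, Finset.sum_mul, mul_assoc, add_assoc]

lemma Params.eventually_affine_atBot :
    ∃ c, ∀ᶠ x in atBot, θ.net x = (∑ i, θ.w₂ i * -relu (-θ.w₁ i)) * x + c := by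
  choose c hc using fun i => eventually_relu_affine_atBot (θ.w₁ i) (θ.b₁ i)
  refine ⟨∑ i, θ.w₂ i * c i + θ.b₂, ?_⟩
  filter_upwards [eventually_all.2 hc] with x hx
  simp only [Params.net, hx, mul_add, Finset.sum_add_distrib, Finset.sum_mul, mul_assoc, add_assoc]

lemma tendsto_div_of_abs_sub_le {l : Filter ℝ} (hl : Tendsto (fun x : ℝ => |x|) l atTop)
    {A C : ℝ} (h : ∀ᶠ x in l, |f x - A * x| ≤ C) : Tendsto (fun x => f x / x) l (𝓝 A) := by
  rw [tendsto_iff_dist_tendsto_zero]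
  refine squeeze_zero' (Eventually.of_forall fun _ => dist_nonneg) ?_
    (hl.const_div_atTop C)
  filter_upwards [h, hl.eventually_gt_atTop 0] with x hx h0
  have hx0 : x ≠ 0 := abs_pos.1 h0
  rw [Real.dist_eq, show f x / x - A = (f x - A * x) / x by field_simp, abs_div]
  gcongr

variable {P Q : ℝ → ℝ} {p₀ p₁ q₀ q₁ : ℝ} {θ : Params} {ε : ℝ}

/-- At bounded distance, `f x / x` and the network's quotient have the same limit; hence the slopes
agree exactly, whatever `ε` is. -/
lemma Params.Within.slope_atTop (h : IsSlopeDecomposition f P Q p₀ p₁ q₀ q₁)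
    (hθ : θ.Within f ε) : ∑ i, θ.w₂ i * relu (θ.w₁ i) = p₁ - q₁ := by
  obtain ⟨c, hc⟩ := θ.eventually_affine_atTop
  refine h.eq_of_tendsto_div_atTop
    (tendsto_div_of_abs_sub_le (C := ε + |c|) tendsto_abs_atTop_atTop ?_)
  filter_upwards [hc] with x hx
  have h1 := hθ x
  rw [hx] at h1
  have h2 := abs_sub (c) ((∑ i, θ.w₂ i * relu (θ.w₁ i)) * x + c - f x)
  rw [show c - ((∑ i, θ.w₂ i * relu (θ.w₁ i)) * x + c - f x) =
    f x - (∑ i, θ.w₂ i * relu (θ.w₁ i)) * x by ring] at h2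
  linarith

lemma Params.Within.slope_atBot (h : IsSlopeDecomposition f P Q p₀ p₁ q₀ q₁)
    (hθ : θ.Within f ε) : ∑ i, θ.w₂ i * -relu (-θ.w₁ i) = p₀ - q₀ := by
  obtain ⟨c, hc⟩ := θ.eventually_affine_atBot
  refine h.eq_of_tendsto_div_atBot
    (tendsto_div_of_abs_sub_le (C := ε + |c|) tendsto_abs_atBot_atTop ?_)
  filter_upwards [hc] with x hx
  have h1 := hθ x
  rw [hx] at h1
  have h2 := abs_sub (c) ((∑ i, θ.w₂ i * -relu (-θ.w₁ i)) * x + c - f x)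
  rw [show c - ((∑ i, θ.w₂ i * -relu (-θ.w₁ i)) * x + c - f x) =
    f x - (∑ i, θ.w₂ i * -relu (-θ.w₁ i)) * x by ring] at h2
  linarith

/-- The end slopes `-[-w]_+` and `[w]_+` of a unit add up to `w`. -/
lemma Params.Within.abs_slope_add_le (h : IsSlopeDecomposition f P Q p₀ p₁ q₀ q₁)
    (hθ : θ.Within f ε) : |(p₀ - q₀) + (p₁ - q₁)| ≤ θ.cost := by
  rw [← hθ.slope_atBot h, ← hθ.slope_atTop h, ← Finset.sum_add_distrib]
  refine ((Finset.abs_sum_le_sum_abs _ _).trans (le_of_eq ?_)).trans θ.sum_abs_mul_le_cost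
  refine Finset.sum_congr rfl fun i _ => ?_
  rw [← abs_mul, ← mul_add, neg_add_eq_sub, relu_sub_relu_neg]

/-- A function approximable by networks to any accuracy is asymptotic to lines. -/
lemma UniformlyApproximable.asymptote_atTop (h : IsSlopeDecomposition f P Q p₀ p₁ q₀ q₁)
    (hu : UniformlyApproximable f) (hε : 0 < ε) :
    ∃ M, ∀ x ≥ M, ∀ y ≥ M, |(f x - (p₁ - q₁) * x) - (f y - (p₁ - q₁) * y)| ≤ ε := by
  obtain ⟨θ, hθ⟩ := hu (ε / 2) (by positivity)
  obtain ⟨c, hc⟩ := θ.eventually_affine_atTop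
  rw [hθ.slope_atTop h] at hc
  obtain ⟨M, hM⟩ := eventually_atTop.1 hc
  refine ⟨M, fun x hx y hy => ?_⟩
  have h1 := abs_le.1 (hθ x)
  have h2 := abs_le.1 (hθ y)
  rw [hM x hx] at h1
  rw [hM y hy] at h2
  rw [abs_le]
  constructor <;> linarith

lemma UniformlyApproximable.asymptote_atBot (h : IsSlopeDecomposition f P Q p₀ p₁ q₀ q₁)
    (hu : UniformlyApproximable f) (hε : 0 < ε) :
    ∃ M, ∀ x ≤ M, ∀ y ≤ M, |(f x - (p₀ - q₀) * x) - (f y - (p₀ - q₀) * y)| ≤ ε := by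
  obtain ⟨θ, hθ⟩ := hu (ε / 2) (by positivity)
  obtain ⟨c, hc⟩ := θ.eventually_affine_atBot
  rw [hθ.slope_atBot h] at hc
  obtain ⟨M, hM⟩ := eventually_atBot.1 hc
  refine ⟨M, fun x hx y hy => ?_⟩
  have h1 := abs_le.1 (hθ x)
  have h2 := abs_le.1 (hθ y)
  rw [hM x hx] at h1
  rw [hM y hy] at h2
  rw [abs_le]
  constructor <;> linarith

end Networks


/-! ### Balanced finite networks and piecewise linear interpolation -/

section FiniteNetworks

lemma relu_mul_of_nonneg {s : ℝ} (hs : 0 ≤ s) (z : ℝ) : relu (s * z) = s * relu z := by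
  rw [relu, relu, mul_max_of_nonneg _ _ hs, mul_zero]

/-- A combination of units with hidden weights `±1` is computed by a balanced network whose cost is
the sum of the absolute values of the coefficients. -/
lemma exists_params_of_sum {ι : Type*} [Fintype ι] (c b ς : ι → ℝ) (hς : ∀ i, ς i ^ 2 = 1)
    (a : ℝ) :
    ∃ θ : Params, (∀ x, θ.net x = ∑ i, c i * relu (ς i * x + b i) + a) ∧ θ.cost = ∑ i, |c i| := by
  let e := (Fintype.equivFin ι).symm
  -- Homogeneity lets the coefficient be shared equally between the layers, the equality case of the
  -- arithmetic-geometric mean inequality.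
  refine ⟨⟨Fintype.card ι, fun i => √|c (e i)| * ς (e i), fun i => √|c (e i)| * b (e i),
    fun i => SignType.sign (c (e i)) * √|c (e i)|, a⟩, fun x => ?_, ?_⟩
  · rw [Params.net]
    congr 1
    rw [← e.sum_comp]
    refine Finset.sum_congr rfl fun i _ => ?_
    dsimp only
    rw [mul_assoc (√|c (e i)|), ← mul_add, relu_mul_of_nonneg (Real.sqrt_nonneg _), ← mul_assoc,
      mul_assoc (SignType.sign (c (e i)) : ℝ), Real.mul_self_sqrt (abs_nonneg _), sign_mul_abs]
  · rw [Params.cost, ← e.sum_comp, Finset.mul_sum]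
    refine Finset.sum_congr rfl fun i _ => ?_
    dsimp only
    rw [mul_pow, mul_pow, hς, Real.sq_sqrt (abs_nonneg _), mul_one]
    rcases lt_trichotomy (c (e i)) 0 with h | h | h
    · simp only [sign_neg h, SignType.coe_neg_one]; ring
    · simp [h]
    · simp only [sign_pos h, SignType.coe_one]; ring

/-- Kinks of total mass `v` supply the slope sum `ρ v`; the rest of `S` is paid for by a linear
term. If `|S| ≤ v` nothing is left over, and otherwise `ρ` is the sign of `S`. -/
lemma exists_balance {v : ℝ} (hv : 0 ≤ v) (S : ℝ) :
    ∃ ρ : ℝ, |ρ| ≤ 1 ∧ v + |S - ρ * v| ≤ max v |S| := by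
  rcases le_or_gt |S| v with h | h
  · rcases hv.eq_or_lt with rfl | hv
    · have : S = 0 := abs_nonpos_iff.1 h
      exact ⟨0, by simp, by simp [this]⟩
    · refine ⟨S / v, ?_, ?_⟩
      · rw [abs_div, abs_of_pos hv]
        exact (div_le_one hv).2 h
      · rw [div_mul_cancel₀ _ hv.ne', sub_self, abs_zero, add_zero]
        exact le_max_left _ _
  · rcases le_total 0 S with hS | hS
    · refine ⟨1, by simp, le_max_of_le_right ?_⟩
      rw [abs_of_nonneg hS] at h ⊢
      rw [abs_of_nonneg (by linarith)]; linarith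
    · refine ⟨-1, by simp, le_max_of_le_right ?_⟩
      rw [abs_of_nonpos hS] at h ⊢
      rw [abs_of_nonpos (by linarith)]; linarith

/-- These are the coefficients of `[x - t]_+` and `[t - x]_+` at a kink `d`. Neither has sign
opposite to `d`, and their difference, the slope sum they contribute, is `ρ |d|`. -/
lemma abs_add_mul_abs_add_abs_sub_le {ρ : ℝ} (hρ : |ρ| ≤ 1) (d : ℝ) :
    |(d + ρ * |d|) / 2| + |(d - ρ * |d|) / 2| ≤ |d| := by
  have h := abs_le.1 hρ
  rcases le_total 0 d with hd | hd
  · rw [abs_of_nonneg hd, abs_of_nonneg (by nlinarith), abs_of_nonneg (by nlinarith)]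
    linarith
  · rw [abs_of_nonpos hd, abs_of_nonpos (by nlinarith), abs_of_nonpos (by nlinarith)]
    linarith

/-- A piecewise linear function with slopes `s₀` and `s₁` at the ends is computed by a network whose
cost is the larger of the variation of its slope and `|s₀ + s₁|`. -/
lemma exists_params_piecewiseLinear (n : ℕ) (d t : ℕ → ℝ) {s₀ s₁ : ℝ} (c : ℝ)
    (hs : ∑ i ∈ Finset.range n, d i = s₁ - s₀) :
    ∃ θ : Params, (∀ x, θ.net x = s₀ * x + c + ∑ i ∈ Finset.range n, d i * relu (x - t i)) ∧
      θ.cost ≤ max (∑ i ∈ Finset.range n, |d i|) |s₀ + s₁| := by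
  set v := ∑ i ∈ Finset.range n, |d i| with hv
  obtain ⟨ρ, hρ, hle⟩ := exists_balance (Finset.sum_nonneg fun i _ => abs_nonneg (d i) : 0 ≤ v)
    (s₀ + s₁)
  -- A term `a x` adds `a` to each of the two end slopes, hence the factor `1 / 2`.
  set a := (s₀ + s₁ - ρ * v) / 2 with ha
  obtain ⟨θ, hθ, hcost⟩ := exists_params_of_sum (ι := (Fin n ⊕ Fin n) ⊕ (Unit ⊕ Unit))
    (Sum.elim (Sum.elim (fun i => (d i + ρ * |d i|) / 2) fun i => (d i - ρ * |d i|) / 2)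
      (Sum.elim (fun _ => a) fun _ => -a))
    (Sum.elim (Sum.elim (fun i => -t i) fun i => t i) (Sum.elim (fun _ => 0) fun _ => 0))
    (Sum.elim (Sum.elim (fun _ => 1) fun _ => -1) (Sum.elim (fun _ => 1) fun _ => -1))
    (by rintro ((_ | _) | (_ | _)) <;> simp)
    -- The output bias absorbs the constants in `[t - x]_+ = [x - t]_+ - x + t`.
    (c - ∑ i ∈ Finset.range n, (d i - ρ * |d i|) / 2 * t i)
  refine ⟨θ, fun x => ?_, ?_⟩
  · rw [hθ]
    simp only [Fintype.sum_sum_type, Sum.elim_inl, Sum.elim_inr, Finset.univ_unique,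
      Finset.sum_const, Finset.card_singleton, one_smul, one_mul, add_zero]
    rw [Fin.sum_univ_eq_sum_range (fun i => (d i + ρ * |d i|) / 2 * relu (x + -t i)) n,
      Fin.sum_univ_eq_sum_range (fun i => (d i - ρ * |d i|) / 2 * relu (-1 * x + t i)) n]
    have h1 (i : ℕ) : (d i - ρ * |d i|) / 2 * relu (-1 * x + t i) =
        (d i - ρ * |d i|) / 2 * relu (x - t i) - x * (d i / 2) + x * (ρ * |d i| / 2) +
          (d i - ρ * |d i|) / 2 * t i := by
      have := relu_sub_relu_neg (x - t i)
      rw [show -1 * x + t i = -(x - t i) by ring,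
        show relu (-(x - t i)) = relu (x - t i) - (x - t i) by linarith]
      ring
    have h2 : a * relu x + -a * relu (-1 * x) = a * x := by
      have := relu_sub_relu_neg x
      rw [neg_one_mul, neg_mul, ← sub_eq_add_neg, ← mul_sub, this]
    have h3 : ∑ i ∈ Finset.range n, d i * relu (x - t i) =
        ∑ i ∈ Finset.range n, (d i + ρ * |d i|) / 2 * relu (x + -t i) +
        ∑ i ∈ Finset.range n, (d i - ρ * |d i|) / 2 * relu (x - t i) := by
      rw [← Finset.sum_add_distrib]
      refine Finset.sum_congr rfl fun i _ => ?_
      rw [← sub_eq_add_neg]; ring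
    rw [h2, h3]
    simp only [h1, Finset.sum_add_distrib, Finset.sum_sub_distrib, ← Finset.mul_sum,
      ← Finset.sum_div, hs, ← hv, ha]
    ring
  · rw [hcost]
    simp only [Fintype.sum_sum_type, Sum.elim_inl, Sum.elim_inr, Finset.univ_unique,
      Finset.sum_const, Finset.card_singleton, one_smul, abs_neg]
    rw [Fin.sum_univ_eq_sum_range (fun i => |(d i + ρ * |d i|) / 2|) n,
      Fin.sum_univ_eq_sum_range (fun i => |(d i - ρ * |d i|) / 2|) n, ← Finset.sum_add_distrib]
    have h1 : |a| + |a| = |s₀ + s₁ - ρ * v| := by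
      rw [ha, abs_div, abs_two]; ring
    rw [h1]
    exact (add_le_add_left (Finset.sum_le_sum fun i _ =>
      abs_add_mul_abs_add_abs_sub_le hρ (d i)) _).trans hle

/-- The piecewise linear function through the points `(tᵢ, f tᵢ)` with slopes `eᵢ`. -/
lemma piecewiseLinear_eq {f : ℝ → ℝ} {t e : ℕ → ℝ} {n : ℕ}
    (he : ∀ i < n, f (t (i + 1)) - f (t i) = e (i + 1) * (t (i + 1) - t i)) {j : ℕ}
    (hj : j ≤ n + 1) {x : ℝ} (h0 : ∀ i < j, t i ≤ x) (h1 : ∀ i, j ≤ i → i ≤ n → x ≤ t i) :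
    e 0 * x + (f (t 0) - e 0 * t 0) +
      ∑ i ∈ Finset.range (n + 1), (e (i + 1) - e i) * relu (x - t i) =
      f (t (j - 1)) + e j * (x - t (j - 1)) := by
  -- Without rectifiers, the first `k` terms produce the `k`-th affine piece. Truncated subtraction
  -- anchors both piece `0` and piece `1` at `t 0`.
  have key : ∀ k ≤ n + 1, e 0 * x + (f (t 0) - e 0 * t 0) +
      ∑ i ∈ Finset.range k, (e (i + 1) - e i) * (x - t i) =
      f (t (k - 1)) + e k * (x - t (k - 1)) := by
    intro k
    induction k with
    | zero => intro _; simp; ring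
    | succ k ih =>
      intro hk
      rw [Finset.sum_range_succ, ← add_assoc, ih (by omega), Nat.add_sub_cancel]
      rcases k with _ | k
      · simp; ring
      · have := he k (by omega)
        rw [Nat.add_sub_cancel]
        linear_combination -this
  rw [← key j hj]
  congr 1
  rw [← Finset.sum_subset (Finset.range_mono hj)]
  · refine Finset.sum_congr rfl fun i hi => ?_
    rw [relu_of_nonneg (sub_nonneg.2 (h0 i (Finset.mem_range.1 hi)))]
  · intro i hi hij
    rw [Finset.mem_range] at hi hij
    rw [relu_of_nonpos (sub_nonpos.2 (h1 i (by omega) (by omega))), mul_zero]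

/-- The averages of `P` over the intervals between `n + 1` knots, preceded by `p₀` and followed by
`p₁`. -/
noncomputable def averages (P : ℝ → ℝ) (p₀ p₁ : ℝ) (t : ℕ → ℝ) (n : ℕ) : ℕ → ℝ
  | 0 => p₀
  | i + 1 => if i < n then (∫ x in t i..t (i + 1), P x) / (t (i + 1) - t i) else p₁

/-- Each average lies between the values of `P` at the ends of its interval. Thus the slopes of the
interpolation inherit the decomposition of `f'`, and their variation telescopes. -/
lemma averages_le_succ {P : ℝ → ℝ} {p₀ p₁ : ℝ} (hP : Monotone P) (hP0 : ∀ x, p₀ ≤ P x)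
    (hP1 : ∀ x, P x ≤ p₁) {t : ℕ → ℝ} (ht : StrictMono t) (n i : ℕ) :
    averages P p₀ p₁ t n i ≤ averages P p₀ p₁ t n (i + 1) := by
  have hmem (i : ℕ) : (∫ x in t i..t (i + 1), P x) / (t (i + 1) - t i) ∈
      Icc (P (t i)) (P (t (i + 1))) := by
    have hlt : t i < t (i + 1) := ht (Nat.lt_succ_self i)
    rw [mem_Icc, le_div_iff₀ (sub_pos.2 hlt), div_le_iff₀ (sub_pos.2 hlt)]
    constructor
    · have := intervalIntegral.integral_mono_on hlt.le (μ := volume) intervalIntegrable_const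
        hP.intervalIntegrable fun x hx => hP hx.1
      rwa [intervalIntegral.integral_const, smul_eq_mul, mul_comm] at this
    · have := intervalIntegral.integral_mono_on hlt.le (μ := volume) hP.intervalIntegrable
        intervalIntegrable_const fun x hx => hP hx.2
      rwa [intervalIntegral.integral_const, smul_eq_mul, mul_comm] at this
  rcases i with _ | i
  · simp only [averages]
    split_ifs with h
    · exact (hP0 _).trans (hmem 0).1
    · exact (hP0 0).trans (hP1 0)
  · simp only [averages]
    split_ifs with h1 h2 h2
    · exact (hmem i).2.trans (hmem (i + 1)).1
    · exact (hmem i).2.trans (hP1 _)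
    · omega
    · exact le_rfl

variable {f P Q : ℝ → ℝ} {p₀ p₁ q₀ q₁ : ℝ}

/-- The piecewise linear interpolation of `f` at the knots `t₀ < … < tₙ`, continued with the slopes
of `f` at `±∞`. -/
lemma IsSlopeDecomposition.exists_params_interpolating
    (h : IsSlopeDecomposition f P Q p₀ p₁ q₀ q₁) {t : ℕ → ℝ} (ht : StrictMono t) (n : ℕ) :
    ∃ θ : Params, θ.cost ≤ max ((p₁ - p₀) + (q₁ - q₀)) |(p₀ - q₀) + (p₁ - q₁)| ∧
      (∀ x ≤ t 0, θ.net x = f (t 0) + (p₀ - q₀) * (x - t 0)) ∧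
      (∀ x, t n ≤ x → θ.net x = f (t n) + (p₁ - q₁) * (x - t n)) ∧
      ∀ i < n, ∀ x ∈ Icc (t i) (t (i + 1)),
        θ.net x = f (t i) + (f (t (i + 1)) - f (t i)) / (t (i + 1) - t i) * (x - t i) := by
  set A := averages P p₀ p₁ t n with hA
  set B := averages Q q₀ q₁ t n with hB
  set e : ℕ → ℝ := fun i => A i - B i with he
  have hA' := averages_le_succ h.monotone_left (fun x => (h.left_mem x).1)
    (fun x => (h.left_mem x).2) ht n
  have hB' := averages_le_succ h.monotone_right (fun x => (h.right_mem x).1)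
    (fun x => (h.right_mem x).2) ht n
  have e0 : e 0 = p₀ - q₀ := rfl
  have e1 : e (n + 1) = p₁ - q₁ := by simp [he, hA, hB, averages]
  have ei (i : ℕ) (hi : i < n) : e (i + 1) = (f (t (i + 1)) - f (t i)) / (t (i + 1) - t i) := by
    simp only [he, hA, hB, averages, if_pos hi]
    rw [← h.integral_eq, intervalIntegral.integral_sub h.monotone_left.intervalIntegrable
      h.monotone_right.intervalIntegrable, sub_div]
  have hchord (i : ℕ) (hi : i < n) :
      f (t (i + 1)) - f (t i) = e (i + 1) * (t (i + 1) - t i) := by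
    rw [ei i hi, div_mul_cancel₀ _ (sub_ne_zero.2 (ht (Nat.lt_succ_self i)).ne')]
  obtain ⟨θ, hθ, hcost⟩ := exists_params_piecewiseLinear (n + 1) (fun i => e (i + 1) - e i) t
    (s₀ := p₀ - q₀) (s₁ := p₁ - q₁) (f (t 0) - e 0 * t 0)
    (by rw [Finset.sum_range_sub, e0, e1])
  have hθ' {j : ℕ} (hj : j ≤ n + 1) {x : ℝ} (h0 : ∀ i < j, t i ≤ x)
      (h1 : ∀ i, j ≤ i → i ≤ n → x ≤ t i) :
      θ.net x = f (t (j - 1)) + e j * (x - t (j - 1)) := by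
    rw [hθ, ← e0, piecewiseLinear_eq hchord hj h0 h1]
  refine ⟨θ, hcost.trans (max_le_max ?_ le_rfl), fun x hx => ?_, fun x hx => ?_,
    fun i hi x hx => ?_⟩
  · calc ∑ i ∈ Finset.range (n + 1), |e (i + 1) - e i|
        ≤ ∑ i ∈ Finset.range (n + 1), ((A (i + 1) - A i) + (B (i + 1) - B i)) := by
          refine Finset.sum_le_sum fun i _ => ?_
          have h1 := hA' i
          have h2 := hB' i
          rw [abs_le]
          constructor <;> simp only [he] <;> linarith
      _ = (p₁ - p₀) + (q₁ - q₀) := by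
          rw [Finset.sum_add_distrib, Finset.sum_range_sub, Finset.sum_range_sub]
          simp [hA, hB, averages]
  · rw [hθ' (j := 0) (by omega) (by simp) fun i _ _ => hx.trans (ht.monotone (Nat.zero_le i))]
    simp [e0]
  · rw [hθ' (j := n + 1) le_rfl (fun i hi => (ht.monotone (by omega)).trans hx)
      (fun i hi hi' => by omega), e1]
    simp
  · rw [hθ' (j := i + 1) (by omega) (fun k hk => (ht.monotone (by omega)).trans hx.1)
      (fun k hk _ => hx.2.trans (ht.monotone hk)), ei i hi]
    simp

lemma exists_grid_cell {a δ x : ℝ} (hδ : 0 < δ) {n : ℕ} (h0 : a ≤ x) (h1 : x < a + n * δ) :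
    ∃ i < n, x ∈ Icc (a + i * δ) (a + ((i + 1 : ℕ) : ℝ) * δ) := by
  have hnn : 0 ≤ (x - a) / δ := div_nonneg (sub_nonneg.2 h0) hδ.le
  refine ⟨⌊(x - a) / δ⌋₊, ?_, ?_, ?_⟩
  · rw [Nat.floor_lt hnn, div_lt_iff₀ hδ]
    linarith
  · have := Nat.floor_le hnn
    rw [le_div_iff₀ hδ] at this
    linarith
  · have := (Nat.lt_floor_add_one ((x - a) / δ)).le
    rw [div_le_iff₀ hδ] at this
    push_cast
    linarith

/-- A uniformly approximable function is approximated, to any accuracy, by a network whose cost is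
at most its norm. -/
theorem exists_within_cost_le (hf : Continuous f) (hV : secondDerivTV f ≠ ⊤)
    (h : IsSlopeDecomposition f P Q p₀ p₁ q₀ q₁) (hu : UniformlyApproximable f) {ε : ℝ}
    (hε : 0 < ε) :
    ∃ θ : Params, θ.Within f ε ∧
      θ.cost ≤ max ((p₁ - p₀) + (q₁ - q₀)) |(p₀ - q₀) + (p₁ - q₁)| := by
  obtain ⟨K, hK⟩ := exists_lipschitzWith hf hV
  obtain ⟨M₁, hM₁⟩ := hu.asymptote_atTop h hε
  obtain ⟨M₀, hM₀⟩ := hu.asymptote_atBot h hε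
  -- This makes the mesh `δ` satisfy `2 K δ ≤ ε`: within a cell both `f` and the interpolation stay
  -- within `K δ` of the value at the left knot. The `1` keeps the length `L` positive.
  obtain ⟨n, hn⟩ := exists_nat_gt (max 0 (max (M₁ - M₀) 1 * (2 * K) / ε))
  have hn0 : (0 : ℝ) < n := (le_max_left _ _).trans_lt hn
  set L := max (M₁ - M₀) 1 with hL
  have hL1 : 1 ≤ L := le_max_right _ _
  have hL2 : M₁ - M₀ ≤ L := le_max_left _ _
  set δ := L / n with hδ
  have hδ0 : 0 < δ := by positivity
  have hnδ : n * δ = L := by rw [hδ]; field_simp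
  have hδε : 2 * K * δ ≤ ε := by
    have := ((le_max_right _ _).trans_lt hn).le
    rw [div_le_iff₀ hε] at this
    rw [hδ, ← mul_div_assoc, div_le_iff₀ hn0]
    linarith
  set t : ℕ → ℝ := fun i => M₀ + i * δ with ht
  have htm : StrictMono t := fun i j hij => by
    simp only [ht]
    have : (i : ℝ) < j := by exact_mod_cast hij
    gcongr
  have ht0 : t 0 = M₀ := by simp [ht]
  have htn : t n = M₀ + L := by simp only [ht]; rw [hnδ]
  obtain ⟨θ, hcost, hleft, hright, hmid⟩ := h.exists_params_interpolating htm n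
  refine ⟨θ, fun x => ?_, hcost⟩
  rcases le_or_gt x (t 0) with hx0 | hx0
  · rw [hleft x hx0, abs_sub_comm]
    have := hM₀ x (hx0.trans_eq ht0) (t 0) ht0.le
    convert this using 2
    ring
  rcases le_or_gt (t n) x with hxn | hxn
  · rw [hright x hxn, abs_sub_comm]
    have := hM₁ x (by linarith) (t n) (by linarith)
    convert this using 2
    ring
  obtain ⟨i, hi, hx⟩ := exists_grid_cell hδ0 (ht0 ▸ hx0.le) (by rw [hnδ]; linarith)
  change x ∈ Icc (t i) (t (i + 1)) at hx
  rw [hmid i hi x hx]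
  have hstep : t (i + 1) - t i = δ := by simp only [ht]; push_cast; ring
  have hx' : |x - t i| ≤ δ := by
    rw [abs_of_nonneg (by linarith [hx.1])]; linarith [hx.2]
  have h1 : |f (t (i + 1)) - f (t i)| ≤ K * δ := by
    have := hK.dist_le_mul (t (i + 1)) (t i)
    rwa [Real.dist_eq, Real.dist_eq, hstep, abs_of_pos hδ0] at this
  have h2 : |f x - f (t i)| ≤ K * δ := by
    have := hK.dist_le_mul x (t i)
    rw [Real.dist_eq, Real.dist_eq] at this
    exact this.trans (mul_le_mul_of_nonneg_left hx' K.coe_nonneg)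
  have h3 : |(f (t (i + 1)) - f (t i)) / (t (i + 1) - t i) * (x - t i)| ≤ K * δ := by
    rw [hstep, abs_mul, abs_div, abs_of_pos hδ0]
    calc _ ≤ K * δ / δ * δ := by gcongr
      _ = K * δ := by field_simp
  have h4 := abs_le.1 h2
  have h5 := abs_le.1 h3
  rw [abs_le]
  constructor <;> linarith

end FiniteNetworks

/-! ### The limit of the cost of uniformly approximating networks -/

section UniformNorm

variable {f : ℝ → ℝ}

theorem tendsto_costWithin (hf : Continuous f) (hu : UniformlyApproximable f) :
    Tendsto (costWithin f) (𝓝[>] 0) (𝓝 (functionNorm f)) := by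
  refine tendsto_order.2 ⟨fun a ha => ?_, fun a ha => ?_⟩
  · by_cases hlt : a < secondDerivTV f
    · obtain ⟨φ, hφ⟩ := lt_iSup_iff.1 hlt
      obtain ⟨hφt, ha⟩ := lt_iSup_iff.1 hφ
      set I := ∫ x, f x * iteratedDeriv 2 φ x
      set C := ∫ x, |iteratedDeriv 2 φ x|
      have hlim : Tendsto (fun ε : ℝ => ENNReal.ofReal (I - ε * C)) (𝓝[>] 0)
          (𝓝 (ENNReal.ofReal I)) := by
        have : Tendsto (fun ε : ℝ => I - ε * C) (𝓝[>] 0) (𝓝 (I - 0 * C)) :=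
          tendsto_const_nhds.sub ((tendsto_id.mono_left nhdsWithin_le_nhds).mul_const C)
        rw [zero_mul, sub_zero] at this
        exact (ENNReal.continuous_ofReal.tendsto _).comp this
      filter_upwards [hlim.eventually_const_lt ha] with ε hε
      refine hε.trans_le (le_iInf₂ fun θ hθ => ENNReal.ofReal_le_ofReal ?_)
      linarith [hθ.integral_mul_le hf hφt]
    · have hV : secondDerivTV f ≠ ⊤ := ((not_lt.1 hlt).trans_lt (lt_of_lt_of_le ha le_top)).ne
      obtain ⟨P, Q, p₀, p₁, q₀, q₁, h, -⟩ := exists_isSlopeDecomposition hf hV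
      have ha' := (lt_max_iff.1 ha).resolve_left hlt
      rw [h.slopeAtTop_eq, h.slopeAtBot_eq] at ha'
      refine Eventually.of_forall fun ε => ha'.trans_le (le_iInf₂ fun θ hθ =>
        ENNReal.ofReal_le_ofReal (hθ.abs_slope_add_le h))
  · have hV : secondDerivTV f ≠ ⊤ := ((le_max_left _ _).trans_lt (ha.trans_le le_top)).ne
    obtain ⟨P, Q, p₀, p₁, q₀, q₁, h, hle⟩ := exists_isSlopeDecomposition hf hV
    filter_upwards [self_mem_nhdsWithin] with ε hε
    obtain ⟨θ, hθ, hcost⟩ := exists_within_cost_le hf hV h hu hε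
    refine ((iInf₂_le θ hθ).trans ?_).trans_lt ha
    rw [functionNorm, h.slopeAtTop_eq, h.slopeAtBot_eq]
    refine (ENNReal.ofReal_le_ofReal hcost).trans ?_
    rw [ENNReal.ofReal_max]
    exact max_le_max hle le_rfl

end UniformNorm


/-! ### Infinite-width networks as differences of positive measures -/

section InfiniteWidth

/-- The parameters `(w, b)` of a hidden unit with `|w| = 1`. -/
abbrev Unit₁ : Type := Metric.sphere (0 : ℝ) 1 × ℝ

/-- The hidden unit `[w x + b]_+` as a function of its parameters. -/
def hidden (x : ℝ) (p : Unit₁) : ℝ := relu ((p.1 : ℝ) * x + p.2)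

lemma abs_coe_sphere (w : Metric.sphere (0 : ℝ) 1) : |(w : ℝ)| = 1 := by
  rw [← Real.norm_eq_abs]
  exact mem_sphere_zero_iff_norm.1 w.2

lemma continuous_hidden : Continuous fun q : ℝ × Unit₁ => hidden q.1 q.2 :=
  continuous_relu.comp (by fun_prop)

lemma continuous_hidden_right (x : ℝ) : Continuous (hidden x) :=
  continuous_hidden.comp (by fun_prop : Continuous fun p : Unit₁ => (x, p))

lemma hidden_nonneg (x : ℝ) (p : Unit₁) : 0 ≤ hidden x p := relu_nonneg _

/-- For finite measures, integrability at `x = 0` thus provides every majorant needed for Fubini and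
dominated convergence. -/
lemma hidden_le (x : ℝ) (p : Unit₁) : hidden x p ≤ |x| + hidden 0 p := by
  have h : (p.1 : ℝ) * x ≤ |x| := by
    refine (le_abs_self _).trans ?_
    rw [abs_mul, abs_coe_sphere, one_mul]
  rw [hidden, hidden, mul_zero, zero_add, relu, relu]
  refine max_le ?_ (by positivity)
  have := le_max_left p.2 0
  linarith

lemma integral_toSignedMeasure_sub {μ ν : Measure Unit₁} [IsFiniteMeasure μ] [IsFiniteMeasure ν]
    {g : Unit₁ → ℝ} (hμ : Integrable g μ) (hν : Integrable g ν) :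
    (μ.toSignedMeasure - ν.toSignedMeasure).integral g (ContinuousLinearMap.lsmul ℝ ℝ) =
      ∫ p, g p ∂μ - ∫ p, g p ∂ν := by
  have hflip : ContinuousLinearMap.lsmul ℝ ℝ = (ContinuousLinearMap.lsmul ℝ ℝ (E := ℝ)).flip := by
    ext; simp
  rw [VectorMeasure.integral_sub_vectorMeasure (by simpa [VectorMeasure.Integrable] using hμ)
    (by simpa [VectorMeasure.Integrable] using hν), hflip, VectorMeasure.integral_toSignedMeasure,
    VectorMeasure.integral_toSignedMeasure]

/-- The measures need not be mutually singular: cancellation in `μ - ν` only lowers the variation.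
-/
lemma infiniteWidthNorm_le {f : ℝ → ℝ} {μ ν : Measure Unit₁} [IsFiniteMeasure μ]
    [IsFiniteMeasure ν] {c : ℝ} (hμ : ∀ x, Integrable (hidden x) μ)
    (hν : ∀ x, Integrable (hidden x) ν)
    (hf : ∀ x, f x = ∫ p, hidden x p ∂μ - ∫ p, hidden x p ∂ν + c) :
    infiniteWidthNorm f ≤ μ univ + ν univ := by
  refine (iInf_le_of_le (μ.toSignedMeasure - ν.toSignedMeasure)
    (iInf_le_of_le c (iInf_le_of_le (fun x => ⟨?_, ?_⟩) ?_)))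
  · exact VectorMeasure.Integrable.sub_vectorMeasure
      (by rw [VectorMeasure.Integrable, Measure.variation_toSignedMeasure]; exact hμ x)
      (by rw [VectorMeasure.Integrable, Measure.variation_toSignedMeasure]; exact hν x)
  · rw [hf, ← integral_toSignedMeasure_sub (hμ x) (hν x)]
    rfl
  · have := VectorMeasure.variation_sub_le (μ := μ.toSignedMeasure) (ν := ν.toSignedMeasure) univ
    simpa using this

lemma Represents.exists_measures {f : ℝ → ℝ} {α : SignedMeasure Unit₁} {c : ℝ}
    (h : Represents α c f) :
    ∃ μ ν : Measure Unit₁, IsFiniteMeasure μ ∧ IsFiniteMeasure ν ∧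
      (∀ x, Integrable (hidden x) μ) ∧ (∀ x, Integrable (hidden x) ν) ∧
      (∀ x, f x = ∫ p, hidden x p ∂μ - ∫ p, hidden x p ∂ν + c) ∧
      μ univ + ν univ = α.variation univ := by
  set j := α.toJordanDecomposition with hj
  have htv : j.posPart + j.negPart = α.variation := by
    rw [← SignedMeasure.totalVariation_eq_variation]
    rfl
  have hi (x : ℝ) : Integrable (hidden x) (j.posPart + j.negPart) := by
    rw [htv]; exact (h x).1
  have hμ (x : ℝ) := (integrable_add_measure.1 (hi x)).1
  have hν (x : ℝ) := (integrable_add_measure.1 (hi x)).2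
  refine ⟨j.posPart, j.negPart, inferInstance, inferInstance, hμ, hν, fun x => ?_, ?_⟩
  · rw [← integral_toSignedMeasure_sub (hμ x) (hν x)]
    have : j.posPart.toSignedMeasure - j.negPart.toSignedMeasure = α :=
      α.toSignedMeasure_toJordanDecomposition
    rw [this]
    exact (h x).2
  · rw [← htv]; rfl

/-! ### Lower bound for the total variation norm -/

section LowerBound

variable {φ : ℝ → ℝ} {μ : Measure Unit₁} [IsFiniteMeasure μ]

lemma integrable_hidden_mul (hμ : Integrable (hidden 0) μ) (hφ : IsTest φ) :
    Integrable (fun q : ℝ × Unit₁ => hidden q.1 q.2 * iteratedDeriv 2 φ q.1)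
      ((volume : Measure ℝ).prod μ) := by
  have h1 : Integrable (fun q : ℝ × Unit₁ => (|q.1| * |iteratedDeriv 2 φ q.1|) * (1 : ℝ))
      ((volume : Measure ℝ).prod μ) :=
    Integrable.mul_prod (f := fun x => |x| * |iteratedDeriv 2 φ x|)
      (((hφ.integrable_mul continuous_id).abs).congr
        (Eventually.of_forall fun x => abs_mul _ _)) (integrable_const 1)
  have h2 : Integrable (fun q : ℝ × Unit₁ => |iteratedDeriv 2 φ q.1| * hidden 0 q.2)
      ((volume : Measure ℝ).prod μ) :=
    Integrable.mul_prod (hφ.continuous_iteratedDeriv.integrable_of_hasCompactSupport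
      hφ.hasCompactSupport_iteratedDeriv).abs hμ
  refine (h1.add h2).mono' ?_ (Eventually.of_forall fun q => ?_)
  · exact (continuous_hidden.mul
      (hφ.continuous_iteratedDeriv.comp continuous_fst)).aestronglyMeasurable
  · rw [Real.norm_eq_abs, abs_mul, abs_of_nonneg (hidden_nonneg _ _)]
    have := mul_le_mul_of_nonneg_right (hidden_le q.1 q.2) (abs_nonneg (iteratedDeriv 2 φ q.1))
    simp only [Pi.add_apply]
    linarith

lemma integrable_integral_hidden_mul (hμ : Integrable (hidden 0) μ) (hφ : IsTest φ) :
    Integrable fun x => (∫ p, hidden x p ∂μ) * iteratedDeriv 2 φ x := by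
  have := (integrable_hidden_mul hμ hφ).integral_prod_left
  simpa only [integral_mul_const] using this

/-- By Fubini the pairing is the `μ`-integral of `φ` at the kinks. -/
lemma abs_integral_integral_hidden_mul_le (hμ : Integrable (hidden 0) μ) (hφ : IsTest φ) :
    |∫ x, (∫ p, hidden x p ∂μ) * iteratedDeriv 2 φ x| ≤ μ.real univ := by
  have h1 : ∫ x, (∫ p, hidden x p ∂μ) * iteratedDeriv 2 φ x =
      ∫ p : Unit₁, φ (-p.2 / p.1) ∂μ := by
    simp_rw [← integral_mul_const]
    rw [integral_integral_swap (integrable_hidden_mul hμ hφ)]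
    refine integral_congr_ae (Eventually.of_forall fun p => ?_)
    simp only [hidden]
    rw [hφ.integral_relu_mul, abs_coe_sphere, one_mul]
  rw [h1]
  have := norm_integral_le_of_norm_le_const (μ := μ) (C := 1)
    (f := fun p : Unit₁ => φ (-p.2 / p.1)) (Eventually.of_forall fun p => hφ.2.2 _)
  simpa using this

lemma tendsto_integral_hidden_div {l : Filter ℝ} [l.IsCountablyGenerated]
    (hl : ∀ᶠ x in l, 1 ≤ |x|) (hμ : Integrable (hidden 0) μ) {s : ℝ → ℝ}
    (hs : ∀ w b, Tendsto (fun x => relu (w * x + b) / x) l (𝓝 (s w))) :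
    Tendsto (fun x => (∫ p, hidden x p ∂μ) / x) l (𝓝 (∫ p : Unit₁, s p.1 ∂μ)) := by
  simp_rw [← integral_div]
  refine tendsto_integral_filter_of_dominated_convergence (fun p => 1 + hidden 0 p) ?_ ?_
    ((integrable_const 1).add hμ) (Eventually.of_forall fun p => hs p.1 p.2)
  · exact Eventually.of_forall fun x =>
      ((continuous_hidden_right x).div_const x).aestronglyMeasurable
  · filter_upwards [hl] with x hx
    refine Eventually.of_forall fun p => ?_
    have h0 : 0 < |x| := by linarith
    rw [Real.norm_eq_abs, abs_div, abs_of_nonneg (hidden_nonneg _ _), div_le_iff₀ h0]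
    have := hidden_le x p
    nlinarith [hidden_nonneg 0 p]

lemma tendsto_relu_div_atTop (w b : ℝ) :
    Tendsto (fun x => relu (w * x + b) / x) atTop (𝓝 (relu w)) := by
  obtain ⟨c, hc⟩ := eventually_relu_affine_atTop w b
  refine tendsto_div_of_abs_sub_le (C := |c|) tendsto_abs_atTop_atTop ?_
  filter_upwards [hc] with x hx
  rw [hx, add_sub_cancel_left]

lemma tendsto_relu_div_atBot (w b : ℝ) :
    Tendsto (fun x => relu (w * x + b) / x) atBot (𝓝 (-relu (-w))) := by
  obtain ⟨c, hc⟩ := eventually_relu_affine_atBot w b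
  refine tendsto_div_of_abs_sub_le (C := |c|) tendsto_abs_atBot_atTop ?_
  filter_upwards [hc] with x hx
  rw [hx, add_sub_cancel_left]

lemma abs_integral_slope_le (μ : Measure Unit₁) [IsFiniteMeasure μ] :
    |(∫ p : Unit₁, -relu (-(p.1 : ℝ)) ∂μ) + ∫ p : Unit₁, relu (p.1 : ℝ) ∂μ| ≤ μ.real univ := by
  have hb (w : Metric.sphere (0 : ℝ) 1) : |relu (w : ℝ)| ≤ 1 ∧ |-relu (-(w : ℝ))| ≤ 1 := by
    have h1 := relu_add_relu_neg (w : ℝ)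
    have h2 := relu_nonneg (w : ℝ)
    have h3 := relu_nonneg (-(w : ℝ))
    rw [abs_coe_sphere] at h1
    rw [abs_neg, abs_of_nonneg h2, abs_of_nonneg h3]
    constructor <;> linarith
  have hc := continuous_relu
  have i1 : Integrable (fun p : Unit₁ => -relu (-(p.1 : ℝ))) μ :=
    Integrable.of_bound (C := 1)
      (by fun_prop : Continuous fun p : Unit₁ => -relu (-(p.1 : ℝ))).aestronglyMeasurable
      (Eventually.of_forall fun p => (hb p.1).2)
  have i2 : Integrable (fun p : Unit₁ => relu (p.1 : ℝ)) μ :=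
    Integrable.of_bound (C := 1)
      (by fun_prop : Continuous fun p : Unit₁ => relu (p.1 : ℝ)).aestronglyMeasurable
      (Eventually.of_forall fun p => (hb p.1).1)
  rw [← integral_add i1 i2]
  have := norm_integral_le_of_norm_le_const (μ := μ) (C := 1)
    (f := fun p : Unit₁ => -relu (-(p.1 : ℝ)) + relu (p.1 : ℝ)) (Eventually.of_forall fun p => by
      rw [neg_add_eq_sub, relu_sub_relu_neg, Real.norm_eq_abs, abs_coe_sphere])
  simpa using this

theorem functionNorm_le_infiniteWidthNorm {f : ℝ → ℝ} (hf : Continuous f) :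
    functionNorm f ≤ infiniteWidthNorm f := by
  refine le_iInf fun α => le_iInf₂ fun c hα => ?_
  obtain ⟨μ, ν, hμf, hνf, hμ, hν, hfe, hvar⟩ := hα.exists_measures
  have hm : α.variation univ = ENNReal.ofReal (μ.real univ + ν.real univ) := by
    rw [← hvar, ENNReal.ofReal_add measureReal_nonneg measureReal_nonneg, ofReal_measureReal,
      ofReal_measureReal]
  rw [hm]
  have hV : secondDerivTV f ≤ ENNReal.ofReal (μ.real univ + ν.real univ) := by
    refine iSup₂_le fun φ hφ => ENNReal.ofReal_le_ofReal ?_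
    replace hφ : IsTest φ := hφ
    have hc : Integrable fun x => c * iteratedDeriv 2 φ x := hφ.integrable_mul continuous_const
    have i1 := integrable_integral_hidden_mul (hμ 0) hφ
    have i2 := integrable_integral_hidden_mul (hν 0) hφ
    have h1 := abs_le.1 (abs_integral_integral_hidden_mul_le (hμ 0) hφ)
    have h2 := abs_le.1 (abs_integral_integral_hidden_mul_le (hν 0) hφ)
    simp_rw [hfe, add_mul, sub_mul]
    have i12 : Integrable fun x => (∫ p, hidden x p ∂μ) * iteratedDeriv 2 φ x -
        (∫ p, hidden x p ∂ν) * iteratedDeriv 2 φ x := i1.sub i2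
    rw [integral_add i12 hc, integral_sub i1 i2, integral_const_mul,
      hφ.integral_iteratedDeriv]
    linarith
  refine max_le hV (ENNReal.ofReal_le_ofReal ?_)
  -- The bound `hV` makes `∫ |f''|` finite, so the end slopes exist and are the limits of `f x / x`.
  obtain ⟨P, Q, p₀, p₁, q₀, q₁, h, -⟩ :=
    exists_isSlopeDecomposition hf (ne_top_of_le_ne_top ENNReal.ofReal_ne_top hV)
  have hdiv (x : ℝ) : f x / x = (∫ p, hidden x p ∂μ) / x - (∫ p, hidden x p ∂ν) / x + c / x := by
    rw [hfe, add_div, sub_div]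
  have hT : (∫ p : Unit₁, relu (p.1 : ℝ) ∂μ) - ∫ p : Unit₁, relu (p.1 : ℝ) ∂ν = p₁ - q₁ := by
    refine h.eq_of_tendsto_div_atTop ?_
    have hl := (tendsto_abs_atTop_atTop (G := ℝ)).eventually_ge_atTop 1
    have := ((tendsto_integral_hidden_div hl (hμ 0) tendsto_relu_div_atTop).sub
      (tendsto_integral_hidden_div hl (hν 0) tendsto_relu_div_atTop)).add
      (tendsto_const_nhds.div_atTop tendsto_id : Tendsto (fun x : ℝ => c / x) atTop (𝓝 0))
    rw [add_zero] at this
    exact this.congr fun x => (hdiv x).symm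
  have hB : (∫ p : Unit₁, -relu (-(p.1 : ℝ)) ∂μ) - ∫ p : Unit₁, -relu (-(p.1 : ℝ)) ∂ν =
      p₀ - q₀ := by
    refine h.eq_of_tendsto_div_atBot ?_
    have hl := (tendsto_abs_atBot_atTop (G := ℝ)).eventually_ge_atTop 1
    have := ((tendsto_integral_hidden_div hl (hμ 0) tendsto_relu_div_atBot).sub
      (tendsto_integral_hidden_div hl (hν 0) tendsto_relu_div_atBot)).add
      (tendsto_const_nhds.div_atBot tendsto_id : Tendsto (fun x : ℝ => c / x) atBot (𝓝 0))
    rw [add_zero] at this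
    exact this.congr fun x => (hdiv x).symm
  rw [h.slopeAtTop_eq, h.slopeAtBot_eq, ← hT, ← hB]
  have h1 := abs_le.1 (abs_integral_slope_le μ)
  have h2 := abs_le.1 (abs_integral_slope_le ν)
  rw [abs_le]
  constructor <;> linarith

end LowerBound

end InfiniteWidth


/-! ### Upper bound: distributing the kinks between the two directions -/

section UpperBound

/-- The unit `x ↦ [x - t]_+`. -/
def rightUnit (t : ℝ) : Unit₁ := (⟨1, by simp⟩, -t)

/-- The unit `x ↦ [t - x]_+`. -/
def leftUnit (t : ℝ) : Unit₁ := (⟨-1, by simp⟩, t)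

lemma hidden_rightUnit (x t : ℝ) : hidden x (rightUnit t) = relu (x - t) := by
  simp [hidden, rightUnit, sub_eq_add_neg]

lemma hidden_leftUnit (x t : ℝ) : hidden x (leftUnit t) = relu (t - x) := by
  simp [hidden, leftUnit, sub_eq_add_neg, add_comm]

lemma measurable_rightUnit : Measurable rightUnit := by unfold rightUnit; fun_prop

lemma measurable_leftUnit : Measurable leftUnit := by unfold leftUnit; fun_prop

lemma integral_indicator_Ici (t x : ℝ) :
    ∫ y in (0 : ℝ)..x, (Ici t).indicator (fun _ => (1 : ℝ)) y = relu (x - t) - relu (-t) := by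
  have hc : Continuous fun y => relu (y - t) := continuous_relu.comp (by fun_prop)
  rw [integral_eq_of_hasDerivAt_off_countable (fun y => relu (y - t)) _ (countable_singleton t)
    hc.continuousOn ?_ ?_]
  · simp
  · intro y hy
    have hyt : y ≠ t := fun h => hy.2 h
    rcases lt_or_gt_of_ne hyt with h | h
    · rw [indicator_of_notMem (by simpa using h)]
      refine (hasDerivAt_const y (0 : ℝ)).congr_of_eventuallyEq ?_
      filter_upwards [eventually_lt_nhds h] with z hz
      exact relu_of_nonpos (by linarith)
    · rw [indicator_of_mem (by simpa using h.le)]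
      refine ((hasDerivAt_id y).sub_const t).congr_of_eventuallyEq ?_
      filter_upwards [eventually_gt_nhds h] with z hz
      exact relu_of_nonneg (by simpa using hz.le)
  · rw [intervalIntegrable_iff]
    exact (integrableOn_const (by simp)).indicator measurableSet_Ici

/-- Fubini for the indicator of `t ≤ y`. Subtracting the value at `x = 0` leaves an integrand
bounded in `t`, so no moment of `ν` is needed. -/
lemma integral_relu_sub_relu (ν : Measure ℝ) [IsFiniteMeasure ν] (x : ℝ) :
    ∫ t, (relu (x - t) - relu (-t)) ∂ν = ∫ y in (0 : ℝ)..x, ν.real (Iic y) := by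
  simp_rw [← integral_indicator_Ici]
  rw [← intervalIntegral_integral_swap]
  · refine intervalIntegral.integral_congr fun y _ => ?_
    have : (fun t => (Ici t).indicator (fun _ => (1 : ℝ)) y) = (Iic y).indicator 1 := by
      ext t
      simp [indicator_apply]
    simp only [this]
    rw [integral_indicator_one measurableSet_Iic]
  · have : Function.uncurry (fun y t => (Ici t).indicator (fun _ => (1 : ℝ)) y) =
        {q : ℝ × ℝ | q.2 ≤ q.1}.indicator 1 := by
      ext q
      simp [indicator_apply, Function.uncurry]
    rw [this]
    have hm : MeasurableSet {q : ℝ × ℝ | q.2 ≤ q.1} :=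
      measurableSet_le measurable_snd measurable_fst
    have : IsFiniteMeasure ((volume : Measure ℝ).restrict (uIoc 0 x)) :=
      ⟨by simp [uIoc]⟩
    exact (integrable_const (1 : ℝ)).indicator hm

/-- The fraction of the kink at `t` assigned to the unit `[x - t]_+`: it is `l` for `|t| ≤ M`. -/
noncomputable def share (l : ℝ≥0) (M t : ℝ) : ℝ≥0 := if t < -M then 0 else if t ≤ M then l else 1

lemma measurable_share (l : ℝ≥0) (M : ℝ) : Measurable (share l M) :=
  Measurable.ite measurableSet_Iio measurable_const
    (Measurable.ite measurableSet_Iic measurable_const measurable_const)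

lemma share_le_one {l : ℝ≥0} (hl : l ≤ 1) (M t : ℝ) : share l M t ≤ 1 := by
  unfold share; split_ifs <;> simp [hl]

/-- The kinks of density `ν` distributed between the units `[x - t]_+` and `[t - x]_+`. -/
noncomputable def split (l : ℝ≥0) (M : ℝ) (ν : Measure ℝ) : Measure Unit₁ :=
  (ν.withDensity fun t => (share l M t : ℝ≥0∞)).map rightUnit +
    (ν.withDensity fun t => ((1 - share l M t : ℝ≥0) : ℝ≥0∞)).map leftUnit

lemma measurable_one_sub_share (l : ℝ≥0) (M : ℝ) : Measurable fun t => 1 - share l M t :=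
  measurable_const.sub (measurable_share l M)

lemma split_univ {l : ℝ≥0} {M : ℝ} (ν : Measure ℝ) (hl : l ≤ 1) : split l M ν univ = ν univ := by
  rw [split, Measure.add_apply, Measure.map_apply measurable_rightUnit MeasurableSet.univ,
    Measure.map_apply measurable_leftUnit MeasurableSet.univ, preimage_univ, preimage_univ,
    withDensity_apply _ MeasurableSet.univ, withDensity_apply _ MeasurableSet.univ,
    Measure.restrict_univ, ← lintegral_add_left (measurable_share l M).coe_nnreal_ennreal]
  rw [← lintegral_one]
  refine lintegral_congr fun t => ?_
  rw [← ENNReal.coe_add, add_tsub_cancel_of_le (share_le_one hl M t), ENNReal.coe_one]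

variable {l : ℝ≥0} {M : ℝ} (ν : Measure ℝ) [IsFiniteMeasure ν]

/-- `[x - t]_+` is large only for `t` near `-∞`, where its share is zero. -/
lemma integrable_share_mul (hl : l ≤ 1) (hM : 0 ≤ M) (x : ℝ) :
    Integrable (fun t => share l M t • relu (x - t)) ν := by
  have hm := measurable_share l M
  refine Integrable.of_bound (C := |x| + M) (hm.smul
    (continuous_relu.comp (by fun_prop : Continuous fun t => x - t)).measurable).aestronglyMeasurable
    (Eventually.of_forall fun t => ?_)
  rw [NNReal.smul_def, smul_eq_mul, norm_mul, Real.norm_eq_abs, Real.norm_eq_abs, NNReal.abs_eq,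
    abs_of_nonneg (relu_nonneg _)]
  by_cases h : t < -M
  · simp only [share, if_pos h, NNReal.coe_zero, zero_mul]
    positivity
  · have h1 : (share l M t : ℝ) ≤ 1 := share_le_one hl M t
    have h2 : relu (x - t) ≤ |x| + M :=
      max_le (by linarith [le_abs_self x]) (by positivity)
    exact (mul_le_of_le_one_left (relu_nonneg _) h1).trans h2

lemma integrable_one_sub_share_mul (hM : 0 ≤ M) (x : ℝ) :
    Integrable (fun t => (1 - share l M t) • relu (t - x)) ν := by
  have hm := (measurable_const (a := (1 : ℝ≥0))).sub (measurable_share l M)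
  refine Integrable.of_bound (C := |x| + M) (hm.smul
    (continuous_relu.comp (by fun_prop : Continuous fun t => t - x)).measurable).aestronglyMeasurable
    (Eventually.of_forall fun t => ?_)
  rw [NNReal.smul_def, smul_eq_mul, norm_mul, Real.norm_eq_abs, Real.norm_eq_abs, NNReal.abs_eq,
    abs_of_nonneg (relu_nonneg _)]
  by_cases h : M < t
  · have : share l M t = 1 := by
      rw [share, if_neg (by linarith), if_neg (by linarith)]
    rw [this, tsub_self, NNReal.coe_zero, zero_mul]
    positivity
  · have h1 : ((1 - share l M t : ℝ≥0) : ℝ) ≤ 1 := by exact_mod_cast tsub_le_self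
    have h2 : relu (t - x) ≤ |x| + M :=
      max_le (by linarith [neg_abs_le x]) (by positivity)
    exact (mul_le_of_le_one_left (relu_nonneg _) h1).trans h2

lemma integrable_hidden_split (hl : l ≤ 1) (hM : 0 ≤ M) (x : ℝ) :
    Integrable (hidden x) (split l M ν) := by
  refine integrable_add_measure.2 ⟨?_, ?_⟩
  · rw [integrable_map_measure (continuous_hidden_right x).aestronglyMeasurable
      measurable_rightUnit.aemeasurable,
      integrable_withDensity_iff_integrable_smul (measurable_share l M)]
    simpa only [Function.comp_apply, hidden_rightUnit] using integrable_share_mul ν hl hM x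
  · rw [integrable_map_measure (continuous_hidden_right x).aestronglyMeasurable
      measurable_leftUnit.aemeasurable,
      integrable_withDensity_iff_integrable_smul (measurable_one_sub_share l M)]
    simpa only [Function.comp_apply, hidden_leftUnit] using integrable_one_sub_share_mul ν hM x

/-- Turning the unit at `t` around subtracts `x - t`. The slope thus drops by the mass turned
around, and the constants go into the value at `0`. -/
lemma integral_hidden_split (hl : l ≤ 1) (hM : 0 ≤ M) (x : ℝ) :
    ∫ p, hidden x p ∂split l M ν = (∫ y in (0 : ℝ)..x, ν.real (Iic y)) -
      (∫ t, (1 - (share l M t : ℝ)) ∂ν) * x + ∫ p, hidden 0 p ∂split l M ν := by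
  have key (x : ℝ) : ∫ p, hidden x p ∂split l M ν =
      ∫ t, (share l M t • relu (x - t) + (1 - share l M t) • relu (t - x)) ∂ν := by
    have hi := integrable_add_measure.1 (integrable_hidden_split ν hl hM x)
    rw [integral_add (integrable_share_mul ν hl hM x) (integrable_one_sub_share_mul ν hM x), split,
      integral_add_measure hi.1 hi.2,
      integral_map measurable_rightUnit.aemeasurable
        (continuous_hidden_right x).aestronglyMeasurable,
      integral_map measurable_leftUnit.aemeasurable
        (continuous_hidden_right x).aestronglyMeasurable,
      integral_withDensity_eq_integral_smul (measurable_share l M),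
      integral_withDensity_eq_integral_smul (measurable_one_sub_share l M)]
    simp only [hidden_rightUnit, hidden_leftUnit]
  have hInt (x : ℝ) : Integrable
      (fun t => share l M t • relu (x - t) + (1 - share l M t) • relu (t - x)) ν :=
    (integrable_share_mul ν hl hM x).add (integrable_one_sub_share_mul ν hM x)
  have hs : Integrable (fun t => (1 - (share l M t : ℝ)) * x) ν := by
    refine Integrable.mul_const (Integrable.of_bound (C := 1)
      (measurable_const.sub (measurable_share l M).coe_nnreal_real).aestronglyMeasurable
      (Eventually.of_forall fun t => ?_)) x
    have h1 : (share l M t : ℝ) ≤ 1 := share_le_one hl M t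
    change |1 - (share l M t : ℝ)| ≤ 1
    rw [abs_le]
    constructor <;> linarith [(share l M t).coe_nonneg]
  have hpt (t : ℝ) : relu (x - t) - relu (-t) =
      (share l M t • relu (x - t) + (1 - share l M t) • relu (t - x)) -
      (share l M t • relu (0 - t) + (1 - share l M t) • relu (t - 0)) +
      (1 - (share l M t : ℝ)) * x := by
    have h1 := relu_sub_relu_neg (x - t)
    have h2 := relu_sub_relu_neg t
    rw [neg_sub] at h1
    simp only [NNReal.smul_def, smul_eq_mul, NNReal.coe_sub (share_le_one hl M t), NNReal.coe_one,
      zero_sub, sub_zero]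
    linear_combination (1 - (share l M t : ℝ)) * h1 + (1 - (share l M t : ℝ)) * h2
  rw [← integral_relu_sub_relu, key x, key 0, ← integral_mul_const]
  simp_rw [hpt]
  have hsub : Integrable (fun t =>
      (share l M t • relu (x - t) + (1 - share l M t) • relu (t - x)) -
      (share l M t • relu (0 - t) + (1 - share l M t) • relu (t - 0))) ν := (hInt x).sub (hInt 0)
  rw [integral_add hsub hs, integral_sub (hInt x) (hInt 0)]
  ring

lemma tendsto_integral_one_sub_share (hl : l ≤ 1) :
    Tendsto (fun n : ℕ => ∫ t, (1 - (share l n t : ℝ)) ∂ν) atTop (𝓝 ((1 - l) * ν.real univ)) := by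
  have h0 : ∫ _ : ℝ, (1 - (l : ℝ)) ∂ν = (1 - l) * ν.real univ := by
    rw [integral_const, smul_eq_mul, mul_comm]
  rw [← h0]
  refine tendsto_integral_of_dominated_convergence (fun _ => 1) (fun n =>
    (measurable_const.sub (measurable_share l n).coe_nnreal_real).aestronglyMeasurable)
    (integrable_const 1) (fun n => Eventually.of_forall fun t => ?_)
    (Eventually.of_forall fun t => ?_)
  · have h1 : (share l n t : ℝ) ≤ 1 := share_le_one hl n t
    rw [Real.norm_eq_abs, abs_le]
    constructor <;> linarith [(share l n t).coe_nonneg]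
  · refine tendsto_const_nhds.congr' ?_
    filter_upwards [tendsto_natCast_atTop_atTop.eventually_ge_atTop |t|] with n hn
    rw [share, if_neg (by linarith [neg_abs_le t]), if_pos (by linarith [le_abs_self t])]

lemma tendsto_stieltjesFunction {P : ℝ → ℝ} (hP : Monotone P) {p₀ p₁ : ℝ}
    (h0 : Tendsto P atBot (𝓝 p₀)) (h1 : Tendsto P atTop (𝓝 p₁)) :
    Tendsto hP.stieltjesFunction atBot (𝓝 p₀) ∧ Tendsto hP.stieltjesFunction atTop (𝓝 p₁) := by
  have hle (x : ℝ) : P x ≤ hP.stieltjesFunction x := by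
    rw [hP.stieltjesFunction_eq]; exact hP.le_rightLim le_rfl
  have hge (x : ℝ) : hP.stieltjesFunction x ≤ P (x + 1) := by
    rw [hP.stieltjesFunction_eq]; exact hP.rightLim_le (lt_add_one x)
  exact ⟨tendsto_of_tendsto_of_tendsto_of_le_of_le h0
      (h0.comp (tendsto_atBot_add_const_right _ 1 tendsto_id)) hle hge,
    tendsto_of_tendsto_of_tendsto_of_le_of_le h1
      (h1.comp (tendsto_atTop_add_const_right _ 1 tendsto_id)) hle hge⟩

/-- The Stieltjes measure of `P` gives `Iic y` the mass `P y - p₀` except at the countably many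
jumps, which the integral does not see. -/
lemma exists_measure_of_monotone {P : ℝ → ℝ} (hP : Monotone P) {p₀ p₁ : ℝ}
    (h0 : Tendsto P atBot (𝓝 p₀)) (h1 : Tendsto P atTop (𝓝 p₁)) :
    ∃ ν : Measure ℝ, IsFiniteMeasure ν ∧ ν univ = ENNReal.ofReal (p₁ - p₀) ∧
      ∀ x, ∫ y in (0 : ℝ)..x, ν.real (Iic y) = (∫ y in (0 : ℝ)..x, P y) - p₀ * x := by
  obtain ⟨t0, t1⟩ := tendsto_stieltjesFunction hP h0 h1
  have hfin := hP.stieltjesFunction.isFiniteMeasure t0 t1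
  refine ⟨hP.stieltjesFunction.measure, hfin, StieltjesFunction.measure_univ _ t0 t1, fun x => ?_⟩
  have hreal (y : ℝ) : hP.stieltjesFunction.measure.real (Iic y) = hP.stieltjesFunction y - p₀ := by
    rw [measureReal_def, StieltjesFunction.measure_Iic _ t0, ENNReal.toReal_ofReal]
    exact sub_nonneg.2 (hP.stieltjesFunction.mono.le_of_tendsto t0 y)
  have hae : ∀ᵐ y, hP.stieltjesFunction y = P y := by
    have := hP.countable_not_continuousAt.measure_zero volume
    filter_upwards [compl_mem_ae_iff.2 this] with y hy
    have hy' : ContinuousAt P y := by simpa using hy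
    rw [hP.stieltjesFunction_eq]
    exact hy'.continuousWithinAt.rightLim_eq
  simp_rw [hreal]
  rw [intervalIntegral.integral_sub hP.stieltjesFunction.mono.intervalIntegrable
    intervalIntegrable_const, intervalIntegral.integral_const, smul_eq_mul, sub_zero, mul_comm x]
  congr 1
  exact intervalIntegral.integral_congr_ae (hae.mono fun y hy _ => hy)

/-- Adding a linear function `a x = a [x]_+ - a [-x]_+` costs at most `2 |a|`. -/
lemma infiniteWidthNorm_le_of_add_linear {f : ℝ → ℝ} {μ ν : Measure Unit₁} [IsFiniteMeasure μ]
    [IsFiniteMeasure ν] {a c : ℝ} (hμ : ∀ x, Integrable (hidden x) μ)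
    (hν : ∀ x, Integrable (hidden x) ν)
    (hf : ∀ x, f x = ∫ p, hidden x p ∂μ - ∫ p, hidden x p ∂ν + a * x + c) :
    infiniteWidthNorm f ≤ μ univ + ν univ + ENNReal.ofReal (2 * |a|) := by
  set D₁ := Measure.dirac (rightUnit 0) with hD₁
  set D₂ := Measure.dirac (leftUnit 0) with hD₂
  set m := a.toNNReal
  set k := (-a).toNNReal
  have hd₁ (x : ℝ) : Integrable (hidden x) D₁ := integrable_dirac (by simp)
  have hd₂ (x : ℝ) : Integrable (hidden x) D₂ := integrable_dirac (by simp)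
  have i₁ (x : ℝ) (r : ℝ≥0) : Integrable (hidden x) (r • D₁) := (hd₁ x).smul_measure_nnreal
  have i₂ (x : ℝ) (r : ℝ≥0) : Integrable (hidden x) (r • D₂) := (hd₂ x).smul_measure_nnreal
  have hmk : (m : ℝ) - k = a := by
    rw [Real.coe_toNNReal', Real.coe_toNNReal']; exact relu_sub_relu_neg a
  have hmk' : (m : ℝ) + k = |a| := by
    rw [Real.coe_toNNReal', Real.coe_toNNReal']; exact relu_add_relu_neg a
  -- Here `m` and `k` are the positive and negative parts of `a`, which keep all four added measures
  -- positive.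
  refine (infiniteWidthNorm_le (μ := μ + (m • D₁ + k • D₂)) (ν := ν + (k • D₁ + m • D₂)) (c := c)
    (fun x => (hμ x).add_measure ((i₁ x m).add_measure (i₂ x k)))
    (fun x => (hν x).add_measure ((i₁ x k).add_measure (i₂ x m))) fun x => ?_).trans_eq ?_
  · rw [integral_add_measure (hμ x) ((i₁ x m).add_measure (i₂ x k)),
      integral_add_measure (hν x) ((i₁ x k).add_measure (i₂ x m)),
      integral_add_measure (i₁ x m) (i₂ x k), integral_add_measure (i₁ x k) (i₂ x m),
      integral_smul_nnreal_measure, integral_smul_nnreal_measure, integral_smul_nnreal_measure,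
      integral_smul_nnreal_measure, integral_dirac, integral_dirac, hidden_rightUnit,
      hidden_leftUnit, hf, sub_zero, zero_sub]
    simp only [NNReal.smul_def, smul_eq_mul]
    have h1 := relu_sub_relu_neg x
    linear_combination (-x) * hmk - ((m : ℝ) - k) * h1
  · have h2 : ENNReal.ofReal (2 * |a|) = 2 * ((m : ℝ≥0∞) + k) := by
      rw [ENNReal.ofReal_mul zero_le_two, ← hmk', ENNReal.ofReal_add m.coe_nonneg k.coe_nonneg,
        ENNReal.ofReal_coe_nnreal, ENNReal.ofReal_coe_nnreal, ENNReal.ofReal_ofNat]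
    rw [h2]
    simp only [Measure.add_apply, Measure.smul_apply, hD₁, hD₂, measure_univ, ENNReal.smul_def,
      smul_eq_mul, mul_one]
    ring

theorem infiniteWidthNorm_le_functionNorm {f : ℝ → ℝ} (hf : Continuous f) :
    infiniteWidthNorm f ≤ functionNorm f := by
  by_cases hV : secondDerivTV f = ⊤
  · simp [functionNorm, hV]
  obtain ⟨P, Q, p₀, p₁, q₀, q₁, h, hle⟩ := exists_isSlopeDecomposition hf hV
  have hp : p₀ ≤ p₁ := (h.left_mem 0).1.trans (h.left_mem 0).2
  have hq : q₀ ≤ q₁ := (h.right_mem 0).1.trans (h.right_mem 0).2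
  obtain ⟨μ, hμf, hμu, hμi⟩ := exists_measure_of_monotone h.monotone_left h.left_atBot h.left_atTop
  obtain ⟨ν, hνf, hνu, hνi⟩ :=
    exists_measure_of_monotone h.monotone_right h.right_atBot h.right_atTop
  have hμr : μ.real univ = p₁ - p₀ := by
    rw [measureReal_def, hμu, ENNReal.toReal_ofReal (by linarith)]
  have hνr : ν.real univ = q₁ - q₀ := by
    rw [measureReal_def, hνu, ENNReal.toReal_ofReal (by linarith)]
  set v := (p₁ - p₀) + (q₁ - q₀) with hv
  set S := (p₀ - q₀) + (p₁ - q₁) with hS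
  obtain ⟨ρ, hρ, hbal⟩ := exists_balance (v := v) (by rw [hv]; linarith) S
  have hρ' := abs_le.1 hρ
  -- Positive and negative kinks lean in opposite directions, so that without the cutoff their slope
  -- sums would be `ρ (p₁ - p₀)` and `ρ (q₁ - q₀)`, together `ρ v`.
  set l : ℝ≥0 := ⟨(1 + ρ) / 2, by linarith⟩ with hl
  set l' : ℝ≥0 := ⟨(1 - ρ) / 2, by linarith⟩ with hl'
  have hl1 : l ≤ 1 := by
    rw [← NNReal.coe_le_coe]; change (1 + ρ) / 2 ≤ 1; linarith
  have hl1' : l' ≤ 1 := by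
    rw [← NNReal.coe_le_coe]; change (1 - ρ) / 2 ≤ 1; linarith
  -- The linear term left over at cutoff `n`. Since `2 a n` tends to `S - ρ v`, the wanted cost is
  -- reached in the limit of the bounds.
  set a : ℕ → ℝ := fun n => (p₀ - q₀) + (∫ t, (1 - (share l n t : ℝ)) ∂μ) -
    ∫ t, (1 - (share l' n t : ℝ)) ∂ν with ha
  have hbound (n : ℕ) : infiniteWidthNorm f ≤ ENNReal.ofReal (v + 2 * |a n|) := by
    have hn : (0 : ℝ) ≤ n := n.cast_nonneg
    have f1 : IsFiniteMeasure (split l n μ) := ⟨by rw [split_univ μ hl1]; exact measure_lt_top _ _⟩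
    have f2 : IsFiniteMeasure (split l' n ν) :=
      ⟨by rw [split_univ ν hl1']; exact measure_lt_top _ _⟩
    refine (infiniteWidthNorm_le_of_add_linear (μ := split l n μ) (ν := split l' n ν) (a := a n)
      (c := f 0 - (∫ p, hidden 0 p ∂split l n μ) + ∫ p, hidden 0 p ∂split l' n ν)
      (integrable_hidden_split μ hl1 hn) (integrable_hidden_split ν hl1' hn)
      fun x => ?_).trans_eq ?_
    · have h1 := h.integral_eq 0 x
      rw [intervalIntegral.integral_sub h.monotone_left.intervalIntegrable
        h.monotone_right.intervalIntegrable] at h1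
      rw [integral_hidden_split μ hl1 hn, integral_hidden_split ν hl1' hn, hμi, hνi]
      simp only [ha]
      linear_combination -h1
    · rw [split_univ μ hl1, split_univ ν hl1', hμu, hνu,
        ← ENNReal.ofReal_add (by linarith) (by linarith),
        ← ENNReal.ofReal_add (by linarith) (by positivity)]
  have hlim : Tendsto (fun n => ENNReal.ofReal (v + 2 * |a n|)) atTop
      (𝓝 (ENNReal.ofReal (v + |S - ρ * v|))) := by
    have h1 := (((tendsto_integral_one_sub_share μ hl1).const_add (p₀ - q₀)).sub
      (tendsto_integral_one_sub_share ν hl1')).abs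
    have h2 := (h1.const_mul 2).const_add v
    refine (ENNReal.continuous_ofReal.tendsto _).comp ?_
    convert! h2 using 2
    rw [hμr, hνr]
    change v + |S - ρ * v| = v + 2 * |p₀ - q₀ + (1 - (1 + ρ) / 2) * (p₁ - p₀) -
      (1 - (1 - ρ) / 2) * (q₁ - q₀)|
    rw [← abs_two (α := ℝ), ← abs_mul, abs_two, hv, hS]
    congr 2
    ring
  refine (ge_of_tendsto' hlim hbound).trans ?_
  rw [functionNorm, h.slopeAtTop_eq, h.slopeAtBot_eq]
  refine (ENNReal.ofReal_le_ofReal hbal).trans ?_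
  rw [ENNReal.ofReal_max]
  exact max_le_max hle le_rfl

end UpperBound

end ReLUNet

theorem theorem3p1 (f : ℝ → ℝ) (hf : Continuous f) :
    -- if `∫ |f''| < ∞`, then `f'` is defined off a countable set and has limits at `±∞`
    (ReLUNet.secondDerivTV f < ⊤ →
      (ReLUNet.diffSet f)ᶜ.Countable ∧
      Tendsto (deriv f) (atBot ⊓ 𝓟 (ReLUNet.diffSet f)) (𝓝 (ReLUNet.slopeAtBot f)) ∧
      Tendsto (deriv f) (atTop ⊓ 𝓟 (ReLUNet.diffSet f)) (𝓝 (ReLUNet.slopeAtTop f))) ∧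
    -- the norm over infinite-width networks equal to `f`
    ReLUNet.infiniteWidthNorm f = ReLUNet.functionNorm f ∧
    -- the limit of the norm over finite networks uniformly approximating `f`
    (ReLUNet.UniformlyApproximable f →
      Tendsto (ReLUNet.costWithin f) (𝓝[>] 0) (𝓝 (ReLUNet.functionNorm f))) ∧
    -- the upper bound
    ReLUNet.functionNorm f ≤
      ReLUNet.secondDerivTV f + 2 * ⨅ x ∈ ReLUNet.diffSet f, ENNReal.ofReal |deriv f x| := by
  refine ⟨fun hV => ?_, le_antisymm (ReLUNet.infiniteWidthNorm_le_functionNorm hf)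
    (ReLUNet.functionNorm_le_infiniteWidthNorm hf), ReLUNet.tendsto_costWithin hf,
    ReLUNet.functionNorm_le_add hf⟩
  obtain ⟨P, Q, p₀, p₁, q₀, q₁, h, -⟩ := ReLUNet.exists_isSlopeDecomposition hf hV.ne
  rw [h.slopeAtBot_eq, h.slopeAtTop_eq]
  exact ⟨h.countable_compl_diffSet, h.tendsto_deriv_atBot, h.tendsto_deriv_atTop⟩
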